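/- **Setting.** Let $\Phi$ be a finite (spherical, not necessarily crystallographic) root system with a basis $B$, let $F\subseteq\mathbb{R}$ be a subfield containing all values $\langle\beta,\alpha^\vee\rangle$ ($\alpha,\beta\in\Phi$), and let $\Lambda$ be a totally ordered abelian group that is an ordered $F$-module (multiplication by positive scalars preserves $<$). The model space is $\mathbb{A}=\mathbb{A}(\Phi,\Lambda)=\mathrm{span}_F(\Phi)\otimes_F\Lambda$, and $\alpha^\vee$ also denotes the map $\mathbb{A}\to\Lambda$, $v\otimes l\mapsto\langle v,\alpha^\vee\rangle l$. Let $W$ be the full affine Weyl group, i.e. the semidirect product of the spherical Weyl group (acting through the first factor) and all translations of $\mathbb{A}$. Half-apartments of $\mathbb{A}$ are the sets $\{x:\alpha^\vee(x)\ge k\}$ with $\alpha\in\Phi$, $k\in\Lambda$; closed convex sets are finite intersections of half-apartments; Weyl chambers are the $W$-images of $\{x:\alpha^\vee(x)\ge 0 \text{ for all }\alpha\in B\}$. Let $d$ be a $W$-invariant $\Lambda$-valued metric on $\mathbb{A}$ that is topologically equivalent to the natural metric $(x,y)\mapsto\sum_{\alpha\in\Phi}|\alpha^\vee(x-y)|$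 (for instance this metric itself). A *space modeled on* $\mathbb{A}$ is a set $X$ with a set $\mathcal{A}$ of injective charts $f:\mathbb{A}\to X$ whose images, the *apartments*, cover $X$. Half-apartments and Weyl chambers of $X$ are the images of those of $\mathbb{A}$ under charts. Consider the following conditions. * (A1) $f\circ w\in\mathcal{A}$ for all $f\in\mathcal{A}$, $w\in W$. * (A2) If $f,g\in\mathcal{A}$ and $f(\mathbb{A})\cap g(\mathbb{A})\ne\emptyset$, then $f^{-1}(g(\mathbb{A}))$ is closed convex and there is $w\in W$ with $f=g\circ w$ on $f^{-1}(g(\mathbb{A}))$. * (A3) Any two points of $X$ lie in a common apartment. * (A4) Any two Weyl chambers of $X$ contain Weyl chambers of $X$ that lie in a common apartment. * (A5) For every apartment $A$ and $x\in A$ there is a retraction $r:X\to A$ (identity on $A$) that does not increase distances and satisfies $r^{-1}(x)=\{x\}$. * (A6) If three apartments pairwise intersect in half-apartments, then the intersection of all three is nonempty. * (TI) The distance on $X$ satisfies the triangle inequality. Here the distance of two points of $X$ is the $d$-distance of their preimages under a chart of an apartment containing both; by (A1)–(A3) it is well defined. An *affine $\Lambda$-building* is a space modeled on $\mathbb{A}$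 satisfying (A1)–(A6). **Theorem.** Assume that $\dim\mathbb{A}=\dim_F\mathrm{span}_F(\Phi)\ge 2$ and that $\Lambda$ contains a sequence $0<\lambda_1<\lambda_2<\cdots$ tending to infinity. Then there is a space $(X,\mathcal{A})$ modeled on $\mathbb{A}$ that satisfies (A1)–(A4), in which no two apartments intersect in a half-apartment, so that (A6) holds vacuously, and which satisfies neither (A5) nor (TI). In particular, for spaces modeled on $\mathbb{A}$ that satisfy (A1)–(A3), the conditions (A4) and (A6) alone do not imply that $(X,\mathcal{A})$ is an affine $\Lambda$-building; that is, (TI) cannot be dropped from the characterization of affine $\Lambda$-buildings by (A4), (TI) and (A6). -/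

import Mathlib

open scoped TensorProduct

universe u v w

noncomputable section

namespace LambdaBuilding

/-! ### The model space

`F` is a subfield of `ℝ` and `P` is a finite (not necessarily crystallographic) root system with
coefficients in `F`: its roots span the `F`-vector space `M`, so `M = span_F Φ`, and the values of
all coroots on all roots lie in `F`.  `Λ` is an ordered abelian group with a compatible
`F`-module structure.  The model space is `span_F Φ ⊗_F Λ`. -/

/-- The model space `span_F Φ ⊗_F Λ`. -/
abbrev ModelSpace (F : Subfield ℝ) (M : Type u) (Λ : Type v)
    [AddCommGroup M] [Module F M] [AddCommGroup Λ] [Module F Λ] : Type (max u v) :=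
  M ⊗[F] Λ

section Model

variable {F : Subfield ℝ} {ι N : Type*} {M : Type u} {Λ : Type v}
  [AddCommGroup M] [Module F M] [AddCommGroup N] [Module F N]
  [AddCommGroup Λ] [Module F Λ]

/-- A basis of a root system: a linearly independent set of roots such that every root is a linear
combination of it with coefficients all nonnegative or all nonpositive. -/
def IsRootBasis (P : RootPairing ι F M N) (B : Finset ι) : Prop :=
  LinearIndepOn F P.root (B : Set ι) ∧
    ∀ i, ∃ c : ι → F, ((∀ j ∈ B, 0 ≤ c j) ∨ (∀ j ∈ B, c j ≤ 0)) ∧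
      P.root i = ∑ j ∈ B, c j • P.root j

/-- The coroot of the root `i`, extended to a map from the model space to `Λ`,
`v ⊗ l ↦ ⟨v, αᵢ^∨⟩ • l`. -/
def corootMap (P : RootPairing ι F M N) (Λ : Type v) [AddCommGroup Λ] [Module F Λ] (i : ι) :
    ModelSpace F M Λ →ₗ[F] Λ :=
  (TensorProduct.lid F Λ).toLinearMap ∘ₗ (P.coroot' i).rTensor Λ

/-- The spherical Weyl group acting on the model space: the group generated by the reflections. -/
def sphericalWeylGroup (P : RootPairing ι F M N) (Λ : Type v) [AddCommGroup Λ] [Module F Λ] :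
    Subgroup (ModelSpace F M Λ ≃ₗ[F] ModelSpace F M Λ) :=
  Subgroup.closure (Set.range fun i => (P.reflection i).rTensor Λ)

/-- The full affine Weyl group `W`, the semidirect product of the spherical Weyl group and the group
of all translations of the model space: the affine maps with linear part in the spherical Weyl
group. -/
def affineWeylGroup (P : RootPairing ι F M N) (Λ : Type v) [AddCommGroup Λ] [Module F Λ] :
    Subgroup (ModelSpace F M Λ ≃ᵃ[F] ModelSpace F M Λ) :=
  (sphericalWeylGroup P Λ).comap AffineEquiv.linearHom

section Order

variable [LinearOrder Λ]

/-- Closed half-apartments of the model space. The negative of a root is again a root, so this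
gives both sides of each wall. -/
def IsHalfApartment (P : RootPairing ι F M N) (S : Set (ModelSpace F M Λ)) : Prop :=
  ∃ (i : ι) (k : Λ), S = {x | k ≤ corootMap P Λ i x}

/-- Closed convex subsets of the model space: finite intersections of closed half-apartments. -/
def IsClosedConvex (P : RootPairing ι F M N) (S : Set (ModelSpace F M Λ)) : Prop :=
  ∃ s : Finset (ι × Λ), S = {x | ∀ p ∈ s, p.2 ≤ corootMap P Λ p.1 x}

/-- The fundamental Weyl chamber of the basis `B`. -/
def fundamentalChamber (P : RootPairing ι F M N) (B : Finset ι) (Λ : Type v) [AddCommGroup Λ]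
    [Module F Λ] [LinearOrder Λ] : Set (ModelSpace F M Λ) :=
  {x | ∀ j ∈ B, 0 ≤ corootMap P Λ j x}

/-- Weyl chambers of the model space: images of the fundamental chamber under the affine Weyl
group. -/
def IsWeylChamber (P : RootPairing ι F M N) (B : Finset ι) (S : Set (ModelSpace F M Λ)) : Prop :=
  ∃ w ∈ affineWeylGroup P Λ, S = w '' fundamentalChamber P B Λ

/-! ### Metrics -/

/-- `Λ`-metrics on a set. -/
structure IsLambdaMetric {Y : Type*} (d : Y → Y → Λ) : Prop where
  eq_zero_iff : ∀ x y, d x y = 0 ↔ x = y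
  symm : ∀ x y, d x y = d y x
  triangle : ∀ x y z, d x y ≤ d x z + d z y

/-- The natural (modified Minkowski) metric of the model space, the sum of all
`|⟨x - y, α^∨⟩|`, where `α` runs through the roots. -/
def naturalMetric [Fintype ι] (P : RootPairing ι F M N) (x y : ModelSpace F M Λ) : Λ :=
  ∑ i, |corootMap P Λ i (x - y)|

/-- Topological equivalence of two `Λ`-valued metrics. -/
def TopEquivalent {Y : Type*} (d d' : Y → Y → Λ) : Prop :=
  ∀ x, ∀ ε : Λ, 0 < ε →
    (∃ δ : Λ, 0 < δ ∧ ∀ y, d x y < δ → d' x y < ε) ∧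
    (∃ δ : Λ, 0 < δ ∧ ∀ y, d' x y < δ → d x y < ε)

/-- The metrics that are allowed on the model space: `W`-invariant `Λ`-metrics that define the same
topology as the natural metric. -/
structure IsModelMetric [Fintype ι] (P : RootPairing ι F M N)
    (d : ModelSpace F M Λ → ModelSpace F M Λ → Λ) : Prop where
  isLambdaMetric : IsLambdaMetric d
  invariant : ∀ w ∈ affineWeylGroup P Λ, ∀ x y, d (w x) (w y) = d x y
  topEquivalent : TopEquivalent d (naturalMetric P)

end Order

end Model

/-! ### Spaces modeled on the model space, and the axioms -/

section Axioms

variable {F : Subfield ℝ} {ι N : Type*} {M : Type u} {Λ : Type v}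
  [AddCommGroup M] [Module F M] [AddCommGroup N] [Module F N]
  [AddCommGroup Λ] [Module F Λ] {X : Type w}

/-- `(X, 𝒜)` is a space modeled on the model space: the charts are injective and their images
cover `X`. -/
def IsModeledSpace (𝒜 : Set (ModelSpace F M Λ → X)) : Prop :=
  (∀ f ∈ 𝒜, Function.Injective f) ∧ ⋃ f ∈ 𝒜, Set.range f = Set.univ

/-- (A1) The atlas is invariant under precomposition with the affine Weyl group. -/
def A1 (P : RootPairing ι F M N) (𝒜 : Set (ModelSpace F M Λ → X)) : Prop :=
  ∀ f ∈ 𝒜, ∀ w ∈ affineWeylGroup P Λ, f ∘ w ∈ 𝒜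

/-- (A2) If two apartments meet, then their intersection is closed and convex in the coordinates of
each of them, and the coordinate change is given by an element of the affine Weyl group. -/
def A2 [LinearOrder Λ] (P : RootPairing ι F M N) (𝒜 : Set (ModelSpace F M Λ → X)) : Prop :=
  ∀ f ∈ 𝒜, ∀ g ∈ 𝒜, (Set.range f ∩ Set.range g).Nonempty →
    IsClosedConvex P (f ⁻¹' Set.range g) ∧
      ∃ w ∈ affineWeylGroup P Λ, Set.EqOn f (g ∘ w) (f ⁻¹' Set.range g)

/-- (A3) Any two points lie in a common apartment. -/
def A3 (𝒜 : Set (ModelSpace F M Λ → X)) : Prop :=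
  ∀ x y : X, ∃ f ∈ 𝒜, x ∈ Set.range f ∧ y ∈ Set.range f

/-- Weyl chambers of `X`. -/
def IsWeylChamberOf [LinearOrder Λ] (P : RootPairing ι F M N) (B : Finset ι)
    (𝒜 : Set (ModelSpace F M Λ → X)) (S : Set X) : Prop :=
  ∃ f ∈ 𝒜, ∃ C : Set (ModelSpace F M Λ), IsWeylChamber P B C ∧ S = f '' C

/-- Half-apartments of `X`. -/
def IsHalfApartmentOf [LinearOrder Λ] (P : RootPairing ι F M N)
    (𝒜 : Set (ModelSpace F M Λ → X)) (S : Set X) : Prop :=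
  ∃ f ∈ 𝒜, ∃ H : Set (ModelSpace F M Λ), IsHalfApartment P H ∧ S = f '' H

/-- (A4) Any two Weyl chambers have sub-Weyl chambers that lie in a common apartment. -/
def A4 [LinearOrder Λ] (P : RootPairing ι F M N) (B : Finset ι)
    (𝒜 : Set (ModelSpace F M Λ → X)) : Prop :=
  ∀ S T : Set X, IsWeylChamberOf P B 𝒜 S → IsWeylChamberOf P B 𝒜 T →
    ∃ S' T' : Set X, IsWeylChamberOf P B 𝒜 S' ∧ IsWeylChamberOf P B 𝒜 T' ∧ S' ⊆ S ∧ T' ⊆ T ∧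
      ∃ f ∈ 𝒜, S' ⊆ Set.range f ∧ T' ⊆ Set.range f

open Classical in
/-- The distance function on `X` that is induced by a metric `d` on the model space: the distance of
two points is the distance of their preimages under a chart whose image contains both. -/
def inducedDist (𝒜 : Set (ModelSpace F M Λ → X)) (d : ModelSpace F M Λ → ModelSpace F M Λ → Λ)
    (x y : X) : Λ :=
  if h : ∃ p : (ModelSpace F M Λ → X) × ModelSpace F M Λ × ModelSpace F M Λ,
      p.1 ∈ 𝒜 ∧ p.1 p.2.1 = x ∧ p.1 p.2.2 = y
  then d h.choose.2.1 h.choose.2.2 else 0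

/-- The induced distance does not depend on the chart that is used to compute it. -/
theorem inducedDist_apply [LinearOrder Λ] (P : RootPairing ι F M N)
    (𝒜 : Set (ModelSpace F M Λ → X)) (d : ModelSpace F M Λ → ModelSpace F M Λ → Λ)
    (hX : IsModeledSpace 𝒜) (h2 : A2 P 𝒜)
    (hd : ∀ w ∈ affineWeylGroup P Λ, ∀ x y, d (w x) (w y) = d x y)
    (f : ModelSpace F M Λ → X) (hf : f ∈ 𝒜) (a b : ModelSpace F M Λ) :
    inducedDist 𝒜 d (f a) (f b) = d a b := by
  have h : ∃ p : (ModelSpace F M Λ → X) × ModelSpace F M Λ × ModelSpace F M Λ,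
      p.1 ∈ 𝒜 ∧ p.1 p.2.1 = f a ∧ p.1 p.2.2 = f b := ⟨(f, a, b), hf, rfl, rfl⟩
  rw [inducedDist, dif_pos h]
  obtain ⟨hg, ha, hb⟩ := h.choose_spec
  obtain ⟨-, w, hw, hfg⟩ := h2 f hf _ hg ⟨f a, ⟨a, rfl⟩, ⟨_, ha⟩⟩
  have ea : h.choose.2.1 = w a :=
    hX.1 _ hg (ha.trans (hfg (show f a ∈ Set.range h.choose.1 from ⟨_, ha⟩)))
  have eb : h.choose.2.2 = w b :=
    hX.1 _ hg (hb.trans (hfg (show f b ∈ Set.range h.choose.1 from ⟨_, hb⟩)))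
  rw [ea, eb, hd w hw]

/-- (A5) For every apartment `A` and every `x ∈ A` there is a retraction of `X` onto `A` that does
not increase distances and for which `x` is the only preimage of `x`. -/
def A5 [LinearOrder Λ] (𝒜 : Set (ModelSpace F M Λ → X))
    (d : ModelSpace F M Λ → ModelSpace F M Λ → Λ) : Prop :=
  ∀ f ∈ 𝒜, ∀ x ∈ Set.range f, ∃ r : X → X,
    (∀ y, r y ∈ Set.range f) ∧ (∀ y ∈ Set.range f, r y = y) ∧
    (∀ y z, inducedDist 𝒜 d (r y) (r z) ≤ inducedDist 𝒜 d y z) ∧ r ⁻¹' {x} = {x}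

/-- (A6) If three apartments pairwise intersect in half-apartments, then they have a common
point. -/
def A6 [LinearOrder Λ] (P : RootPairing ι F M N) (𝒜 : Set (ModelSpace F M Λ → X)) : Prop :=
  ∀ f ∈ 𝒜, ∀ g ∈ 𝒜, ∀ h ∈ 𝒜,
    IsHalfApartmentOf P 𝒜 (Set.range f ∩ Set.range g) →
    IsHalfApartmentOf P 𝒜 (Set.range f ∩ Set.range h) →
    IsHalfApartmentOf P 𝒜 (Set.range g ∩ Set.range h) →
    (Set.range f ∩ Set.range g ∩ Set.range h).Nonempty

/-- (TI) The induced distance satisfies the triangle inequality. -/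
def TI [LinearOrder Λ] (𝒜 : Set (ModelSpace F M Λ → X))
    (d : ModelSpace F M Λ → ModelSpace F M Λ → Λ) : Prop :=
  ∀ x y z, inducedDist 𝒜 d x y ≤ inducedDist 𝒜 d x z + inducedDist 𝒜 d z y

/-- Affine `Λ`-buildings. -/
structure IsAffineBuilding [LinearOrder Λ] (P : RootPairing ι F M N) (B : Finset ι)
    (d : ModelSpace F M Λ → ModelSpace F M Λ → Λ) (𝒜 : Set (ModelSpace F M Λ → X)) : Prop where
  modeled : IsModeledSpace 𝒜
  a1 : A1 P 𝒜
  a2 : A2 P 𝒜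
  a3 : A3 𝒜
  a4 : A4 P B 𝒜
  a5 : A5 𝒜 d
  a6 : A6 P 𝒜

end Axioms

end LambdaBuilding

end

/-! Two apartments are made to meet either not at all, or in a single small piece, or entirely. The
model space is cut into classes by `classSetoid`: points whose coroot values all have absolute value
at least `k` are grouped by Weyl chamber, and any other point is identified only with points having
the same coroot values. Every class is closed convex (`isClosedConvex_pointClass_fiber`), every Weyl
chamber has a subchamber inside one class (`IsWeylChamber.exists_subset_fiber`), and in dimension at
least two no half-apartment lies in one class (`IsHalfApartment.exists_pointClass_ne`).

Now take a linear space (any two points lie on a line, and distinct lines share at most one point)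
whose points carry a class as kind. Replace each point by a copy of its class, and let each line
become an apartment whose points are indexed by the classes. Joining points by lines gives (A3) and
(A4). The uniqueness of lines gives (A2) and excludes intersections that are half-apartments, so
(A6) is vacuous.

The linear space is built freely and completed by Zorn's lemma (`IsPartialLinear.exists_linear`), so
nothing ties the position of two points on a new line to distances already present. Two apartments
through the origin each contain a point `a` close to it. These two copies of `a` are joined by a
third apartment in which they sit at the origin and at `q`, with `d o a + d o a < d o q`. Thus (TI)
fails (`Gluing.exists_system_not_TI`), and with it (A5) (`TI_of_A5`). -/

namespace LambdaBuilding

/-! ### The affine Weyl group acting on coroots, half-apartments and chambers -/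

section AffineWeylGroup

variable {F : Subfield ℝ} {ι N : Type*} {M : Type u} {Λ : Type v}
  [AddCommGroup M] [Module F M] [AddCommGroup N] [Module F N]
  [AddCommGroup Λ] [Module F Λ]

@[simp]
theorem corootMap_tmul (P : RootPairing ι F M N) (i : ι) (m : M) (l : Λ) :
    corootMap P Λ i (m ⊗ₜ[F] l) = P.coroot' i m • l := by
  simp [corootMap]

theorem corootMap_reflection (P : RootPairing ι F M N) (i j : ι) (x : ModelSpace F M Λ) :
    corootMap P Λ j ((P.reflection i).rTensor Λ x) = corootMap P Λ (P.reflectionPerm i j) x := by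
  induction x using TensorProduct.induction_on with
  | zero => simp
  | tmul m l =>
    rw [LinearEquiv.rTensor_tmul, corootMap_tmul, corootMap_tmul, P.coroot'_reflection]
  | add x y hx hy => rw [map_add, map_add, hx, hy, map_add]

theorem exists_corootMap_of_mem_sphericalWeylGroup (P : RootPairing ι F M N)
    {w : ModelSpace F M Λ ≃ₗ[F] ModelSpace F M Λ} (hw : w ∈ sphericalWeylGroup P Λ) (i : ι) :
    ∃ j, ∀ x, corootMap P Λ i (w x) = corootMap P Λ j x := by
  -- The claim for the inverse is carried along, since the induction over the generated subgroup has
  -- an inversion step.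
  suffices h : (∀ i, ∃ j, ∀ x, corootMap P Λ i (w x) = corootMap P Λ j x) ∧
      ∀ i, ∃ j, ∀ x, corootMap P Λ i (w⁻¹ x) = corootMap P Λ j x from h.1 i
  clear i
  induction hw using Subgroup.closure_induction with
  | mem w hw =>
    obtain ⟨i, rfl⟩ := hw
    have h : ∀ j, ∀ x, corootMap P Λ j ((P.reflection i).rTensor Λ x) =
        corootMap P Λ (P.reflectionPerm i j) x := corootMap_reflection P i
    refine ⟨fun j => ⟨_, h j⟩, fun j => ⟨P.reflectionPerm i j, fun x => ?_⟩⟩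
    have h' := h (P.reflectionPerm i j) (((P.reflection i).rTensor Λ)⁻¹ x)
    rw [P.reflectionPerm_self] at h'
    rw [← h']
    congr 1
    exact LinearEquiv.apply_symm_apply _ _
  | one => exact ⟨fun i => ⟨i, fun _ => rfl⟩, fun i => ⟨i, fun _ => rfl⟩⟩
  | mul a b _ _ ha hb =>
    refine ⟨fun i => ?_, fun i => ?_⟩
    · obtain ⟨j, hj⟩ := ha.1 i
      obtain ⟨k, hk⟩ := hb.1 j
      exact ⟨k, fun x => (hj _).trans (hk _)⟩
    · obtain ⟨j, hj⟩ := hb.2 i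
      obtain ⟨k, hk⟩ := ha.2 j
      exact ⟨k, fun x => by rw [mul_inv_rev]; exact (hj _).trans (hk _)⟩
  | inv a _ ha => exact ⟨ha.2, by rw [inv_inv]; exact ha.1⟩

/-- The linear part permutes the coroots and the translation only adds a constant. This is what
transports closed convex sets and half-apartments along the group. -/
theorem exists_corootMap_of_mem_affineWeylGroup (P : RootPairing ι F M N)
    {w : ModelSpace F M Λ ≃ᵃ[F] ModelSpace F M Λ} (hw : w ∈ affineWeylGroup P Λ) (i : ι) :
    ∃ j c, ∀ x, corootMap P Λ i (w x) = corootMap P Λ j x + c := by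
  obtain ⟨j, hj⟩ := exists_corootMap_of_mem_sphericalWeylGroup P (Subgroup.mem_comap.1 hw) i
  refine ⟨j, corootMap P Λ i (w 0), fun x => ?_⟩
  have h : w x = w.linear x + w 0 := by
    simpa using w.map_vadd 0 x
  rw [h, map_add]
  exact congrArg (· + _) (hj x)

theorem constVAdd_mem_affineWeylGroup (P : RootPairing ι F M N) (a : ModelSpace F M Λ) :
    AffineEquiv.constVAdd F (ModelSpace F M Λ) a ∈ affineWeylGroup P Λ :=
  Subgroup.mem_comap.2 (one_mem (sphericalWeylGroup P Λ))

theorem reflection_mem_affineWeylGroup (P : RootPairing ι F M N) (i : ι) :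
    ((P.reflection i).rTensor Λ).toAffineEquiv ∈ affineWeylGroup P Λ :=
  Subgroup.mem_comap.2 (Subgroup.subset_closure ⟨i, rfl⟩)

variable [LinearOrder Λ] {P : RootPairing ι F M N}

theorem isClosedConvex_univ : IsClosedConvex P (Set.univ : Set (ModelSpace F M Λ)) :=
  ⟨∅, by simp⟩

theorem IsClosedConvex.preimage [IsOrderedAddMonoid Λ] {S : Set (ModelSpace F M Λ)} (hS : IsClosedConvex P S)
    {w : ModelSpace F M Λ ≃ᵃ[F] ModelSpace F M Λ} (hw : w ∈ affineWeylGroup P Λ) :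
    IsClosedConvex P (w ⁻¹' S) := by
  classical
  obtain ⟨s, rfl⟩ := hS
  choose j c h using exists_corootMap_of_mem_affineWeylGroup P hw
  refine ⟨s.image fun p => (j p.1, p.2 - c p.1), ?_⟩
  ext x
  simp only [Set.mem_preimage, Set.mem_ofPred_eq, Finset.forall_mem_image, h, sub_le_iff_le_add]

theorem IsHalfApartment.image [IsOrderedAddMonoid Λ] {S : Set (ModelSpace F M Λ)} (hS : IsHalfApartment P S)
    {w : ModelSpace F M Λ ≃ᵃ[F] ModelSpace F M Λ} (hw : w ∈ affineWeylGroup P Λ) :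
    IsHalfApartment P (w '' S) := by
  obtain ⟨i, k, rfl⟩ := hS
  obtain ⟨j, c, h⟩ := exists_corootMap_of_mem_affineWeylGroup P (inv_mem hw) i
  refine ⟨j, k - c, ?_⟩
  ext x
  refine (Set.mem_image_equiv (f := w.toEquiv) (S := {x | k ≤ corootMap P Λ i x})).trans ?_
  simp only [Set.mem_ofPred_eq, sub_le_iff_le_add]
  exact Iff.of_eq (congrArg (k ≤ ·) (h x))

theorem IsWeylChamber.image {B : Finset ι} {S : Set (ModelSpace F M Λ)} (hS : IsWeylChamber P B S)
    {w : ModelSpace F M Λ ≃ᵃ[F] ModelSpace F M Λ} (hw : w ∈ affineWeylGroup P Λ) :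
    IsWeylChamber P B (w '' S) := by
  obtain ⟨w', hw', rfl⟩ := hS
  exact ⟨w * w', mul_mem hw hw', (Set.image_comp w w' _).symm⟩

end AffineWeylGroup

/-! ### From a linear space to a space with an atlas -/

/-- A linear space whose points `t` carry a kind, such that every line meets each class of the
model space in exactly one point; the class is identified by the affine Weyl group with the class
that is the kind of the point. -/
structure ApartmentSystem {F : Subfield ℝ} {ι N : Type*} {M : Type u} {Λ : Type v}
    [AddCommGroup M] [Module F M] [AddCommGroup N] [Module F N] [AddCommGroup Λ] [Module F Λ]
    (P : RootPairing ι F M N) {K : Type*} (cls : ModelSpace F M Λ → K) (T I : Type*) where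
  kind : T → K
  line : I → K → T
  coord : I → K → ModelSpace F M Λ ≃ᵃ[F] ModelSpace F M Λ
  line_injective : ∀ i, Function.Injective (line i)
  coord_mem : ∀ i κ, coord i κ ∈ affineWeylGroup P Λ
  cls_coord_iff : ∀ i κ x, cls (coord i κ x) = kind (line i κ) ↔ cls x = κ
  eq_of_mem : ∀ i j s t, s ≠ t → s ∈ Set.range (line i) → t ∈ Set.range (line i) →
    s ∈ Set.range (line j) → t ∈ Set.range (line j) → i = j
  exists_line : ∀ s t, ∃ i, s ∈ Set.range (line i) ∧ t ∈ Set.range (line i)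

namespace ApartmentSystem

variable {F : Subfield ℝ} {ι N : Type*} {M : Type u} {Λ : Type v}
  [AddCommGroup M] [Module F M] [AddCommGroup N] [Module F N] [AddCommGroup Λ] [Module F Λ]
  {P : RootPairing ι F M N} {K : Type*} {cls : ModelSpace F M Λ → K} {T I : Type*}
  (S : ApartmentSystem P cls T I)

/-- The space of an apartment system. -/
def Space : Type _ := {x : T × ModelSpace F M Λ // cls x.2 = S.kind x.1}

/-- The chart of a line. -/
noncomputable def chart (i : I) (x : ModelSpace F M Λ) : S.Space :=
  ⟨(S.line i (cls x), S.coord i (cls x) x), (S.cls_coord_iff i (cls x) x).2 rfl⟩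

/-- The atlas generated by the charts of the lines. -/
def atlas : Set (ModelSpace F M Λ → S.Space) :=
  {f | ∃ i, ∃ w ∈ affineWeylGroup P Λ, f = S.chart i ∘ w}

theorem chart_mem_atlas (i : I) : S.chart i ∈ S.atlas := ⟨i, 1, one_mem _, rfl⟩

theorem chart_injective (i : I) : Function.Injective (S.chart i) := by
  intro x y h
  have h1 := congrArg (fun z : S.Space => z.1.1) h
  have h2 := congrArg (fun z : S.Space => z.1.2) h
  have hc : cls x = cls y := S.line_injective i h1
  simp only [chart, hc] at h2
  exact (S.coord i (cls y)).injective h2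

/-- A line carries the whole copy of the class at each of its points, so incidence of points and
apartments can be decided in the linear space. -/
theorem mem_range_chart {i : I} {x : S.Space} :
    x ∈ Set.range (S.chart i) ↔ x.1.1 ∈ Set.range (S.line i) := by
  constructor
  · rintro ⟨y, rfl⟩
    exact ⟨_, rfl⟩
  · rintro ⟨κ, hκ⟩
    have hx : S.coord i κ ((S.coord i κ).symm x.1.2) = x.1.2 :=
      (S.coord i κ).apply_symm_apply _
    have hc : cls ((S.coord i κ).symm x.1.2) = κ := by
      rw [← S.cls_coord_iff i, hx, hκ]
      exact x.2
    refine ⟨(S.coord i κ).symm x.1.2, Subtype.ext (Prod.ext ?_ ?_)⟩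
    · simp only [chart, hc, hκ]
    · simp only [chart, hc, hx]

theorem range_chart_comp (i : I) (w : ModelSpace F M Λ ≃ᵃ[F] ModelSpace F M Λ) :
    Set.range (S.chart i ∘ w) = Set.range (S.chart i) :=
  w.surjective.range_comp _

theorem isModeledSpace_atlas : IsModeledSpace S.atlas := by
  constructor
  · rintro _ ⟨i, w, -, rfl⟩
    exact (S.chart_injective i).comp w.injective
  · refine Set.eq_univ_of_forall fun x => ?_
    obtain ⟨i, hi, -⟩ := S.exists_line x.1.1 x.1.1
    exact Set.mem_biUnion (S.chart_mem_atlas i) (S.mem_range_chart.2 hi)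

theorem a1_atlas : A1 P S.atlas := by
  rintro _ ⟨i, w, hw, rfl⟩ w' hw'
  exact ⟨i, w * w', mul_mem hw hw', rfl⟩

theorem a3_atlas : A3 S.atlas := by
  intro x y
  obtain ⟨i, hx, hy⟩ := S.exists_line x.1.1 y.1.1
  exact ⟨_, S.chart_mem_atlas i, S.mem_range_chart.2 hx, S.mem_range_chart.2 hy⟩

variable [LinearOrder Λ]

/-- Distinct lines have at most one common point, so the overlap of their apartments is at most one
class. On that class the coordinate change is a composite of the gluing maps. -/
theorem a2_atlas [IsOrderedAddMonoid Λ] (hcls : ∀ κ, IsClosedConvex P (cls ⁻¹' {κ})) :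
    A2 P S.atlas := by
  rintro _ ⟨i, w₁, hw₁, rfl⟩ _ ⟨j, w₂, hw₂, rfl⟩ hne
  rw [range_chart_comp, range_chart_comp] at hne
  rw [range_chart_comp]
  by_cases hij : i = j
  · subst hij
    have h : S.chart i ∘ w₁ ⁻¹' Set.range (S.chart i) = Set.univ :=
      Set.eq_univ_of_forall fun x => ⟨w₁ x, rfl⟩
    rw [h]
    refine ⟨isClosedConvex_univ, w₂⁻¹ * w₁, mul_mem (inv_mem hw₂) hw₁, fun x _ => ?_⟩
    exact congrArg (S.chart i) (w₂.apply_symm_apply (w₁ x)).symm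
  · obtain ⟨z, hzi, hzj⟩ := hne
    rw [mem_range_chart] at hzi hzj
    obtain ⟨κ, hκ⟩ := hzi
    obtain ⟨κ', hκ'⟩ := hzj
    have h : S.chart i ∘ w₁ ⁻¹' Set.range (S.chart j) = w₁ ⁻¹' (cls ⁻¹' {κ}) := by
      ext x
      rw [Set.mem_preimage, mem_range_chart]
      change S.line i (cls (w₁ x)) ∈ _ ↔ cls (w₁ x) = κ
      constructor
      · intro hx
        by_contra hne
        exact hij (S.eq_of_mem i j _ _ (fun e => hne (S.line_injective i e))
          ⟨_, rfl⟩ ⟨κ, rfl⟩ hx ⟨κ', hκ'.trans hκ.symm⟩)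
      · rintro rfl
        exact ⟨κ', hκ'.trans hκ.symm⟩
    rw [h]
    refine ⟨(hcls κ).preimage hw₁, w₂⁻¹ * ((S.coord j κ')⁻¹ * (S.coord i κ * w₁)),
      mul_mem (inv_mem hw₂) (mul_mem (inv_mem (S.coord_mem j κ')) (mul_mem (S.coord_mem i κ) hw₁)),
      fun x hx => ?_⟩
    have hx : cls (w₁ x) = κ := hx
    set y := (S.coord j κ').symm (S.coord i κ (w₁ x)) with hy
    have hy' : S.coord j κ' y = S.coord i κ (w₁ x) := (S.coord j κ').apply_symm_apply _
    have hc : cls y = κ' := by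
      rw [← S.cls_coord_iff j, hy', hκ', ← hκ]
      exact (S.cls_coord_iff i κ _).2 hx
    have e : w₂ ((w₂⁻¹ * ((S.coord j κ')⁻¹ * (S.coord i κ * w₁)) :
        ModelSpace F M Λ ≃ᵃ[F] ModelSpace F M Λ) x) = y := w₂.apply_symm_apply y
    change S.chart i (w₁ x) = S.chart j (w₂ _)
    rw [e]
    refine Subtype.ext (Prod.ext ?_ ?_)
    · simp only [chart, hx, hc, hκ, hκ']
    · simp only [chart, hx, hc, hy']

/-- After shrinking, each chamber sits over a single point of the linear space, and the line through
the two points gives the apartment. -/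
theorem a4_atlas {B : Finset ι}
    (hch : ∀ C : Set (ModelSpace F M Λ), IsWeylChamber P B C →
      ∃ C' ⊆ C, IsWeylChamber P B C' ∧ ∃ κ, C' ⊆ cls ⁻¹' {κ}) :
    A4 P B S.atlas := by
  have key : ∀ Q, IsWeylChamberOf P B S.atlas Q → ∃ Q' ⊆ Q, IsWeylChamberOf P B S.atlas Q' ∧
      ∃ t, ∀ x ∈ Q', x.1.1 = t := by
    rintro _ ⟨_, ⟨i, w, hw, rfl⟩, C, hC, rfl⟩
    obtain ⟨C', hC', hW, κ, hκ⟩ := hch _ (hC.image hw)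
    refine ⟨S.chart i '' C', ?_, ⟨_, S.chart_mem_atlas i, C', hW, rfl⟩, S.line i κ, ?_⟩
    · rw [Set.image_comp]
      exact Set.image_mono hC'
    · rintro _ ⟨x, hx, rfl⟩
      exact congrArg (S.line i) (hκ hx)
  intro Q R hQ hR
  obtain ⟨Q', hQQ, hQ', s, hs⟩ := key Q hQ
  obtain ⟨R', hRR, hR', t, ht⟩ := key R hR
  obtain ⟨i, hi, hi'⟩ := S.exists_line s t
  refine ⟨Q', R', hQ', hR', hQQ, hRR, _, S.chart_mem_atlas i, fun x hx => ?_, fun x hx => ?_⟩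
  · exact S.mem_range_chart.2 (hs x hx ▸ hi)
  · exact S.mem_range_chart.2 (ht x hx ▸ hi')

/-- A half-apartment meets two classes, hence involves two points of the linear space. If it were
the intersection, the lines would all coincide, and the intersection would be a whole apartment. -/
theorem not_isHalfApartmentOf_inter [IsOrderedAddMonoid Λ]
    (hH : ∀ H : Set (ModelSpace F M Λ), IsHalfApartment P H →
      H ≠ Set.univ ∧ ∃ x ∈ H, ∃ y ∈ H, cls x ≠ cls y) :
    ∀ f ∈ S.atlas, ∀ g ∈ S.atlas, ¬ IsHalfApartmentOf P S.atlas (Set.range f ∩ Set.range g) := by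
  rintro _ ⟨i, w₁, hw₁, rfl⟩ _ ⟨j, w₂, hw₂, rfl⟩ ⟨_, ⟨m, w, hw, rfl⟩, H, hHA, he⟩
  rw [range_chart_comp, range_chart_comp, Set.image_comp] at he
  obtain ⟨hne, x, hx, y, hy, hxy⟩ := hH _ (hHA.image hw)
  have hx' : S.chart m x ∈ Set.range (S.chart i) ∩ Set.range (S.chart j) := he ▸ ⟨x, hx, rfl⟩
  have hy' : S.chart m y ∈ Set.range (S.chart i) ∩ Set.range (S.chart j) := he ▸ ⟨y, hy, rfl⟩
  simp only [Set.mem_inter_iff, mem_range_chart] at hx' hy'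
  have hs := fun e => hxy (S.line_injective m e)
  obtain rfl := S.eq_of_mem m i _ _ hs ⟨_, rfl⟩ ⟨_, rfl⟩ hx'.1 hy'.1
  obtain rfl := S.eq_of_mem m j _ _ hs ⟨_, rfl⟩ ⟨_, rfl⟩ hx'.2 hy'.2
  refine hne (Set.eq_univ_of_forall fun z => ?_)
  have hz : S.chart m z ∈ S.chart m '' (w '' H) := he ▸ ⟨⟨z, rfl⟩, ⟨z, rfl⟩⟩
  obtain ⟨z', hz', e⟩ := hz
  exact S.chart_injective m e ▸ hz'

end ApartmentSystem

/-! ### Logical relations between the axioms -/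

section Axioms

variable {F : Subfield ℝ} {ι N : Type*} {M : Type u} {Λ : Type v}
  [AddCommGroup M] [Module F M] [AddCommGroup N] [Module F N]
  [AddCommGroup Λ] [Module F Λ] [LinearOrder Λ] {X : Type w}
  {P : RootPairing ι F M N} {𝒜 : Set (ModelSpace F M Λ → X)}
  {d : ModelSpace F M Λ → ModelSpace F M Λ → Λ}

/-- Retract onto an apartment containing `x` and `y`: this fixes both, moves `z` into the apartment
without increasing distances, and there the triangle inequality of `d` applies. -/
theorem TI_of_A5 [IsOrderedAddMonoid Λ] (hX : IsModeledSpace 𝒜) (h2 : A2 P 𝒜) (h3 : A3 𝒜) (h5 : A5 𝒜 d)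
    (hd : ∀ w ∈ affineWeylGroup P Λ, ∀ x y, d (w x) (w y) = d x y)
    (htri : ∀ x y z, d x y ≤ d x z + d z y) : TI 𝒜 d := by
  intro x y z
  obtain ⟨f, hf, hx, hy⟩ := h3 x y
  obtain ⟨r, hr, hr', hr'', -⟩ := h5 f hf x hx
  have h := add_le_add (hr'' x z) (hr'' z y)
  refine le_trans ?_ h
  rw [hr' x hx, hr' y hy]
  obtain ⟨a, rfl⟩ := hx
  obtain ⟨b, rfl⟩ := hy
  obtain ⟨c, hc⟩ := hr z
  rw [← hc]
  simpa only [inducedDist_apply P 𝒜 d hX h2 hd f hf] using htri a b c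

theorem A6_of_not_isHalfApartmentOf_inter
    (h : ∀ f ∈ 𝒜, ∀ g ∈ 𝒜, ¬ IsHalfApartmentOf P 𝒜 (Set.range f ∩ Set.range g)) : A6 P 𝒜 :=
  fun f hf g hg _ _ hfg _ _ => (h f hf g hg hfg).elim

end Axioms

/-! ### Free completion to a linear space -/

section FreeLinearSpace

variable {K : Type w}

/-- The points of a free linear space: three atoms, and for any two points `p`, `q` the points of
a line through `p` and `q`. -/
inductive FreePoint (K : Type w) : Type w
  | atom (n : Fin 3) : FreePoint K
  | node (p q : FreePoint K) (κ : K) : FreePoint K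

namespace FreePoint

theorem node_ne_left (p q : FreePoint K) (κ : K) : node p q κ ≠ p := fun h => by
  have h' := congrArg sizeOf h
  simp only [node.sizeOf_spec] at h'
  omega

theorem node_ne_right (p q : FreePoint K) (κ : K) : node p q κ ≠ q := fun h => by
  have h' := congrArg sizeOf h
  simp only [node.sizeOf_spec] at h'
  omega

/-- The kind of a point. All atoms have kind `κ₀`. -/
def kind (κ₀ : K) : FreePoint K → K
  | atom _ => κ₀
  | node _ _ κ => κ

variable (i j : FreePoint K → FreePoint K → K)

open Classical in
/-- The line that is generated by `l.1` and `l.2`, which are put at the positions `i l.1 l.2` and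
`j l.1 l.2`. -/
noncomputable def line (l : FreePoint K × FreePoint K) (κ : K) : FreePoint K :=
  if κ = i l.1 l.2 then l.1 else if κ = j l.1 l.2 then l.2 else node l.1 l.2 κ

variable {i j}

theorem line_left (p q : FreePoint K) : line i j (p, q) (i p q) = p := by
  simp [line]

theorem line_right (hij : ∀ p q, i p q ≠ j p q) (p q : FreePoint K) :
    line i j (p, q) (j p q) = q := by
  simp [line, (hij p q).symm]

theorem line_of_ne {p q : FreePoint K} {κ : K} (hi : κ ≠ i p q) (hj : κ ≠ j p q) :
    line i j (p, q) κ = node p q κ := by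
  simp [line, hi, hj]

theorem line_injective {l : FreePoint K × FreePoint K} (h : l.1 ≠ l.2) :
    Function.Injective (line i j l) := by
  intro κ κ' e
  unfold line at e
  split_ifs at e with h1 h2 h3 h4 h5 h6 h7 h8
  · exact h1.trans h2.symm
  · exact (h e).elim
  · exact (node_ne_left _ _ _ e.symm).elim
  · exact (h e.symm).elim
  · exact h4.trans h6.symm
  · exact (node_ne_right _ _ _ e.symm).elim
  · exact (node_ne_left _ _ _ e).elim
  · exact (node_ne_right _ _ _ e).elim
  · exact (node.inj e).2.2

theorem eq_or_eq_or_eq_node_of_mem {p q t : FreePoint K} (h : t ∈ Set.range (line i j (p, q))) :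
    t = p ∨ t = q ∨ ∃ κ, t = node p q κ := by
  obtain ⟨κ, rfl⟩ := h
  unfold line
  split_ifs
  · exact Or.inl rfl
  · exact Or.inr (Or.inl rfl)
  · exact Or.inr (Or.inr ⟨κ, rfl⟩)

variable (i j)

/-- The points on the lines in `L`. -/
def support (L : Set (FreePoint K × FreePoint K)) : Set (FreePoint K) :=
  {t | ∃ l ∈ L, t ∈ Set.range (line i j l)}

/-- `t` is an atom or was generated by a line in `L`. -/
def IsGenerated (L : Set (FreePoint K × FreePoint K)) (t : FreePoint K) : Prop :=
  ∀ a b κ, t = node a b κ → (a, b) ∈ L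

/-- `L` is a partial linear space that contains the line through each of its nodes that generates
this node. -/
structure IsPartialLinear (L : Set (FreePoint K × FreePoint K)) : Prop where
  fst_ne_snd : ∀ l ∈ L, l.1 ≠ l.2
  isGenerated : ∀ t ∈ support i j L, IsGenerated L t
  eq_of_mem : ∀ l ∈ L, ∀ l' ∈ L, ∀ s t, s ≠ t → s ∈ Set.range (line i j l) →
    t ∈ Set.range (line i j l) → s ∈ Set.range (line i j l') → t ∈ Set.range (line i j l') → l = l'

variable {i j}

theorem IsGenerated.mono {L L' : Set (FreePoint K × FreePoint K)} {t : FreePoint K}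
    (h : IsGenerated L t) (hL : L ⊆ L') : IsGenerated L' t :=
  fun a b κ e => hL (h a b κ e)

theorem isPartialLinear_empty : IsPartialLinear i j ∅ :=
  ⟨fun _ h => h.elim, fun _ ⟨_, h, _⟩ => h.elim, fun _ h => h.elim⟩

/-- The nodes of the new line occur on no old line, since an old line could carry them only if `(p,
q)` were already in `L`. So a second line sharing two points with the new one would contain both `p`
and `q`. -/
theorem IsPartialLinear.insert (hij : ∀ p q, i p q ≠ j p q)
    {L : Set (FreePoint K × FreePoint K)} (hL : IsPartialLinear i j L)
    {p q : FreePoint K} (hpq : p ≠ q) (hp : IsGenerated L p) (hq : IsGenerated L q)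
    (h : ¬ ∃ l ∈ L, p ∈ Set.range (line i j l) ∧ q ∈ Set.range (line i j l)) :
    IsPartialLinear i j (insert (p, q) L) := by
  have hnot : (p, q) ∉ L := fun hm => h ⟨_, hm, ⟨_, line_left p q⟩, ⟨_, line_right hij p q⟩⟩
  have key : ∀ l ∈ L, ∀ s t, s ≠ t → s ∈ Set.range (line i j (p, q)) →
      t ∈ Set.range (line i j (p, q)) → s ∈ Set.range (line i j l) →
      t ∈ Set.range (line i j l) → False := by
    intro l hl s t hst hs ht hs' ht'
    have aux : ∀ r, r ∈ Set.range (line i j (p, q)) → r ∈ Set.range (line i j l) →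
        r = p ∨ r = q := by
      intro r hr hr'
      obtain hr | hr | ⟨κ, hr⟩ := eq_or_eq_or_eq_node_of_mem hr
      · exact Or.inl hr
      · exact Or.inr hr
      · exact (hnot (hL.isGenerated r ⟨l, hl, hr'⟩ p q κ hr)).elim
    obtain rfl | rfl := aux s hs hs' <;> obtain rfl | rfl := aux t ht ht'
    · exact hst rfl
    · exact h ⟨l, hl, hs', ht'⟩
    · exact h ⟨l, hl, ht', hs'⟩
    · exact hst rfl
  refine ⟨?_, ?_, ?_⟩
  · rintro l (rfl | hl)
    · exact hpq
    · exact hL.fst_ne_snd l hl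
  · rintro t ⟨l, rfl | hl, ht⟩
    · obtain rfl | rfl | ⟨κ, rfl⟩ := eq_or_eq_or_eq_node_of_mem ht
      · exact hp.mono (Set.subset_insert _ _)
      · exact hq.mono (Set.subset_insert _ _)
      · intro a b κ' e
        obtain ⟨rfl, rfl, -⟩ := node.inj e
        exact Set.mem_insert _ _
    · exact (hL.isGenerated t ⟨l, hl, ht⟩).mono (Set.subset_insert _ _)
  · rintro l (rfl | hl) l' (rfl | hl') s t hst hs ht hs' ht'
    · rfl
    · exact (key l' hl' s t hst hs ht hs' ht').elim
    · exact (key l hl s t hst hs' ht' hs ht).elim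
    · exact hL.eq_of_mem l hl l' hl' s t hst hs ht hs' ht'

/-- In a maximal partial linear space two unjoined points could still be joined by a new line. -/
theorem IsPartialLinear.exists_linear (hij : ∀ p q, i p q ≠ j p q)
    {L₀ : Set (FreePoint K × FreePoint K)} (hL₀ : IsPartialLinear i j L₀) :
    ∃ L, L₀ ⊆ L ∧ IsPartialLinear i j L ∧ ∀ s ∈ support i j L, ∀ t ∈ support i j L,
      ∃ l ∈ L, s ∈ Set.range (line i j l) ∧ t ∈ Set.range (line i j l) := by
  obtain ⟨L, hL₀L, hL⟩ := zorn_subset_nonempty {L | IsPartialLinear i j L} (by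
    intro c hc hchain _
    refine ⟨⋃₀ c, ⟨?_, ?_, ?_⟩, fun s hs => Set.subset_sUnion_of_mem hs⟩
    · rintro l ⟨L, hL, hl⟩
      exact (hc hL).fst_ne_snd l hl
    · rintro t ⟨l, ⟨L, hL, hl⟩, ht⟩
      exact ((hc hL).isGenerated t ⟨l, hl, ht⟩).mono (Set.subset_sUnion_of_mem hL)
    · rintro l ⟨L, hL, hl⟩ l' ⟨L', hL', hl'⟩
      obtain h | h := hchain.total hL hL'
      · exact (hc hL').eq_of_mem l (h hl) l' hl'
      · exact (hc hL).eq_of_mem l hl l' (h hl')) L₀ hL₀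
  refine ⟨L, hL₀L, hL.prop, fun s hs t ht => ?_⟩
  obtain rfl | hst := eq_or_ne s t
  · obtain ⟨l, hl, hs⟩ := hs
    exact ⟨l, hl, hs, hs⟩
  · by_contra h
    have h' := hL.prop.insert hij hst (hL.prop.isGenerated s hs) (hL.prop.isGenerated t ht) h
    have hm : (s, t) ∈ L := hL.le_of_ge h' (Set.subset_insert _ _) (Set.mem_insert _ _)
    exact h ⟨_, hm, ⟨_, line_left s t⟩, ⟨_, line_right hij s t⟩⟩

/-- There is a linear space that contains the lines through the first and each of the other two
atoms, and a line that is generated by a node on the one and a node on the other. -/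
theorem exists_linear_triangle (hij : ∀ p q, i p q ≠ j p q) (κ : K) :
    ∃ L, IsPartialLinear i j L ∧ (∀ s ∈ support i j L, ∀ t ∈ support i j L,
        ∃ l ∈ L, s ∈ Set.range (line i j l) ∧ t ∈ Set.range (line i j l)) ∧
      (atom 0, atom 1) ∈ L ∧ (atom 0, atom 2) ∈ L ∧
      (node (atom 0) (atom 1) κ, node (atom 0) (atom 2) κ) ∈ L := by
  have g : ∀ (L : Set (FreePoint K × FreePoint K)) n, IsGenerated L (atom n) :=
    fun L n a b κ e => by cases e
  have H1 := isPartialLinear_empty.insert hij (p := atom 0) (q := atom 1) (by simp) (g _ _) (g _ _)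
    (by simp)
  have H2 := H1.insert hij (p := atom 0) (q := atom 2) (by simp) (g _ _) (g _ _) (by
    rintro ⟨l, rfl | h, -, hl⟩
    · obtain h | h | ⟨κ, h⟩ := eq_or_eq_or_eq_node_of_mem hl <;> simp at h
    · exact h)
  have H3 := H2.insert hij (p := node (atom 0) (atom 1) κ) (q := node (atom 0) (atom 2) κ)
    (by simp)
    (fun a b κ' e => by obtain ⟨rfl, rfl, -⟩ := node.inj e; simp)
    (fun a b κ' e => by obtain ⟨rfl, rfl, -⟩ := node.inj e; simp) (by
      -- Apart from atoms, each of the two old lines contains only its own nodes, so neither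
      -- contains both of the new generators.
      rintro ⟨l, rfl | rfl | h, hl, hl'⟩
      · obtain h | h | ⟨κ, h⟩ := eq_or_eq_or_eq_node_of_mem hl <;> simp at h
      · obtain h | h | ⟨κ, h⟩ := eq_or_eq_or_eq_node_of_mem hl' <;> simp at h
      · exact h)
  obtain ⟨L, hsub, hL, hlin⟩ := H3.exists_linear hij
  exact ⟨L, hL, hlin, hsub (by simp), hsub (by simp), hsub (by simp)⟩

end FreePoint

end FreeLinearSpace

/-! ### Positions of points on lines, and failure of the triangle inequality -/

section Gluing

variable {F : Subfield ℝ} {ι N : Type*} {M : Type u} {Λ : Type v}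
  [AddCommGroup M] [Module F M] [AddCommGroup N] [Module F N] [AddCommGroup Λ] [Module F Λ]

/-- For any two classes `κ` and `κ'` of the model space, two different classes `left κ κ'` and
`right κ κ'`, and elements of the affine Weyl group that map these classes to `κ` and `κ'`. -/
structure Gluing (P : RootPairing ι F M N) {K : Type*} (cls : ModelSpace F M Λ → K) where
  left : K → K → K
  right : K → K → K
  toLeft : K → K → ModelSpace F M Λ ≃ᵃ[F] ModelSpace F M Λ
  toRight : K → K → ModelSpace F M Λ ≃ᵃ[F] ModelSpace F M Λ
  left_ne_right : ∀ κ κ', left κ κ' ≠ right κ κ'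
  toLeft_mem : ∀ κ κ', toLeft κ κ' ∈ affineWeylGroup P Λ
  toRight_mem : ∀ κ κ', toRight κ κ' ∈ affineWeylGroup P Λ
  cls_toLeft_iff : ∀ κ κ' x, cls (toLeft κ κ' x) = κ ↔ cls x = left κ κ'
  cls_toRight_iff : ∀ κ κ' x, cls (toRight κ κ' x) = κ' ↔ cls x = right κ κ'

namespace Gluing

variable {P : RootPairing ι F M N} {K : Type w} {cls : ModelSpace F M Λ → K} (G : Gluing P cls)
  (κ₀ : K)

/-- The position of `p` on the line generated by `p` and `q`. -/
def leftPos (p q : FreePoint K) : K := G.left (p.kind κ₀) (q.kind κ₀)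

/-- The position of `q` on the line generated by `p` and `q`. -/
def rightPos (p q : FreePoint K) : K := G.right (p.kind κ₀) (q.kind κ₀)

open Classical in
/-- The apartment system of a linear space of free points. -/
noncomputable def system {L : Set (FreePoint K × FreePoint K)}
    (hL : FreePoint.IsPartialLinear (G.leftPos κ₀) (G.rightPos κ₀) L)
    (hlin : ∀ s ∈ FreePoint.support (G.leftPos κ₀) (G.rightPos κ₀) L,
      ∀ t ∈ FreePoint.support (G.leftPos κ₀) (G.rightPos κ₀) L, ∃ l ∈ L,
        s ∈ Set.range (FreePoint.line (G.leftPos κ₀) (G.rightPos κ₀) l) ∧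
        t ∈ Set.range (FreePoint.line (G.leftPos κ₀) (G.rightPos κ₀) l)) :
    ApartmentSystem P cls (FreePoint.support (G.leftPos κ₀) (G.rightPos κ₀) L) L where
  kind t := t.1.kind κ₀
  line l κ := ⟨FreePoint.line (G.leftPos κ₀) (G.rightPos κ₀) l.1 κ, l.1, l.2, κ, rfl⟩
  coord l κ :=
    if κ = G.leftPos κ₀ l.1.1 l.1.2 then G.toLeft (l.1.1.kind κ₀) (l.1.2.kind κ₀)
    else if κ = G.rightPos κ₀ l.1.1 l.1.2 then G.toRight (l.1.1.kind κ₀) (l.1.2.kind κ₀)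
    -- A node at position `κ` has kind `κ`, so no coordinate change is needed there.
    else 1
  line_injective l κ κ' h :=
    FreePoint.line_injective (hL.fst_ne_snd l.1 l.2) (congrArg Subtype.val h)
  coord_mem l κ := by
    split_ifs
    · exact G.toLeft_mem _ _
    · exact G.toRight_mem _ _
    · exact one_mem _
  cls_coord_iff l κ x := by
    unfold FreePoint.line
    dsimp only
    split_ifs with h h'
    · rw [G.cls_toLeft_iff, h]
      rfl
    · rw [G.cls_toRight_iff, h']
      rfl
    · rfl
  eq_of_mem := by
    rintro ⟨l, hl⟩ ⟨l', hl'⟩ s t hst ⟨a, rfl⟩ ⟨b, rfl⟩ ⟨c, hc⟩ ⟨e, he⟩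
    exact Subtype.ext (hL.eq_of_mem l hl l' hl' _ _ (fun h => hst (Subtype.ext h)) ⟨a, rfl⟩ ⟨b, rfl⟩
      ⟨c, congrArg Subtype.val hc⟩ ⟨e, congrArg Subtype.val he⟩)
  exists_line := by
    rintro ⟨s, hs⟩ ⟨t, ht⟩
    obtain ⟨l, hl, ⟨a, ha⟩, ⟨b, hb⟩⟩ := hlin s hs t ht
    exact ⟨⟨l, hl⟩, ⟨a, Subtype.ext ha⟩, ⟨b, Subtype.ext hb⟩⟩

variable [LinearOrder Λ] [IsOrderedAddMonoid Λ]

/-- If points can be glued at a distance that is larger than it should be, then there is an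
apartment system for which the triangle inequality fails. -/
theorem exists_system_not_TI (hcls : ∀ κ, IsClosedConvex P (cls ⁻¹' {κ}))
    {o a q : ModelSpace F M Λ} (hoa : cls a ≠ cls o) (hqa : cls a ≠ cls q)
    (hsub : ∀ b ∈ ({o, a} : Set (ModelSpace F M Λ)), ∀ x, cls x = cls b → x = b)
    (hleft : ∀ b ∈ ({o, a} : Set (ModelSpace F M Λ)), G.left (cls b) (cls b) = cls o)
    (hright : ∀ b ∈ ({o, a} : Set (ModelSpace F M Λ)), G.right (cls b) (cls b) = cls q)
    {d : ModelSpace F M Λ → ModelSpace F M Λ → Λ}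
    (hd : ∀ w ∈ affineWeylGroup P Λ, ∀ x y, d (w x) (w y) = d x y)
    (hsymm : ∀ x y, d x y = d y x) (hlt : d o a + d o a < d o q) :
    ∃ (T I : Type w) (S : ApartmentSystem P cls T I), ¬ TI S.atlas d := by
  obtain ⟨L, hL, hlin, h1, h2, h3⟩ := FreePoint.exists_linear_triangle
    (i := G.leftPos (cls o)) (j := G.rightPos (cls o)) (fun _ _ => G.left_ne_right _ _) (cls a)
  set S := G.system (cls o) hL hlin with hS
  refine ⟨_, _, S, fun hTI => ?_⟩
  have hdist : ∀ (l : L) x y, inducedDist S.atlas d (S.chart l x) (S.chart l y) = d x y := fun l =>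
    inducedDist_apply P S.atlas d S.isModeledSpace_atlas (S.a2_atlas hcls) hd _
      (S.chart_mem_atlas l)
  have ho : o ∈ ({o, a} : Set (ModelSpace F M Λ)) := Or.inl rfl
  have ha : a ∈ ({o, a} : Set (ModelSpace F M Λ)) := Or.inr rfl
  -- Over a point whose kind is the class of `o` or `a`, the copy of the class is a singleton, so
  -- equality in the linear space suffices.
  have ext : ∀ b ∈ ({o, a} : Set (ModelSpace F M Λ)), ∀ (x y : S.Space), x.1.1 = y.1.1 →
      S.kind x.1.1 = cls b → x = y := by
    intro b hb x y hxy hx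
    refine Subtype.ext (Prod.ext hxy ?_)
    rw [hsub b hb _ (x.2.trans hx), hsub b hb _ (y.2.trans (hxy ▸ hx))]
  have left : ∀ l : L, ∀ b ∈ ({o, a} : Set (ModelSpace F M Λ)), l.1.1.kind (cls o) = cls b →
      l.1.2.kind (cls o) = cls b → (S.chart l o).1.1.1 = l.1.1 := by
    rintro ⟨⟨p, p'⟩, hl⟩ b hb e e'
    have h : cls o = G.leftPos (cls o) p p' := by
      unfold leftPos
      simp only at e e'
      rw [e, e', hleft b hb]
    change FreePoint.line _ _ (p, p') (cls o) = p
    exact (congrArg _ h).trans (FreePoint.line_left p p')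
  have right : ∀ l : L, ∀ b ∈ ({o, a} : Set (ModelSpace F M Λ)), l.1.1.kind (cls o) = cls b →
      l.1.2.kind (cls o) = cls b → (S.chart l q).1.1.1 = l.1.2 := by
    rintro ⟨⟨p, p'⟩, hl⟩ b hb e e'
    have h : cls q = G.rightPos (cls o) p p' := by
      unfold rightPos
      simp only at e e'
      rw [e, e', hright b hb]
    change FreePoint.line _ _ (p, p') (cls q) = p'
    exact (congrArg _ h).trans (FreePoint.line_right (fun _ _ => G.left_ne_right _ _) p p')
  have mid : ∀ l : L, l.1.1.kind (cls o) = cls o → l.1.2.kind (cls o) = cls o →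
      (S.chart l a).1.1.1 = .node l.1.1 l.1.2 (cls a) := by
    rintro ⟨⟨p, p'⟩, hl⟩ e e'
    simp only at e e'
    refine FreePoint.line_of_ne ?_ ?_
    · unfold leftPos
      rwa [e, e', hleft o ho]
    · unfold rightPos
      rwa [e, e', hright o ho]
  set l1 : L := ⟨_, h1⟩
  set l2 : L := ⟨_, h2⟩
  set l3 : L := ⟨_, h3⟩
  -- The triangle: `l1` and `l2` share `atom 0` at position `o`, and `l3` joins their nodes at
  -- position `a`, placing them at `o` and `q`.
  have e0 : S.chart l1 o = S.chart l2 o :=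
    ext o ho _ _ (Subtype.ext ((left l1 o ho rfl rfl).trans (left l2 o ho rfl rfl).symm))
      (congrArg (FreePoint.kind (cls o)) (left l1 o ho rfl rfl))
  have e1 : S.chart l3 o = S.chart l1 a :=
    ext a ha _ _ (Subtype.ext ((left l3 a ha rfl rfl).trans (mid l1 rfl rfl).symm))
      (congrArg (FreePoint.kind (cls o)) (left l3 a ha rfl rfl))
  have e2 : S.chart l3 q = S.chart l2 a :=
    ext a ha _ _ (Subtype.ext ((right l3 a ha rfl rfl).trans (mid l2 rfl rfl).symm))
      (congrArg (FreePoint.kind (cls o)) (right l3 a ha rfl rfl))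
  have h := hTI (S.chart l3 o) (S.chart l3 q) (S.chart l1 o)
  rw [hdist, e1, e2, hdist, e0, hdist, hsymm a o] at h
  exact absurd h (not_le.2 hlt)

end Gluing

end Gluing

/-! ### Simple coroots and regular vectors -/

section RootSystem

variable {F : Subfield ℝ} {ι N : Type*} {M : Type u} {Λ : Type v}
  [AddCommGroup M] [Module F M] [AddCommGroup N] [Module F N]
  [AddCommGroup Λ] [Module F Λ] (P : RootPairing ι F M N)

theorem corootMap_reflectionPerm_self (i : ι) (x : ModelSpace F M Λ) :
    corootMap P Λ (P.reflectionPerm i i) x = -corootMap P Λ i x := by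
  induction x using TensorProduct.induction_on with
  | zero => simp
  | tmul m l =>
    have h : P.coroot (P.reflectionPerm i i) = -P.coroot i := by simp
    simp only [corootMap_tmul, LinearMap.flip_apply, h, map_neg, neg_smul]
  | add x y hx hy => rw [map_add, map_add, hx, hy, neg_add]

theorem corootMap_eq_sum {B : Finset ι} {i : ι} {c : ι → F}
    (h : P.coroot i = ∑ j ∈ B, c j • P.coroot j) (x : ModelSpace F M Λ) :
    corootMap P Λ i x = ∑ j ∈ B, c j • corootMap P Λ j x := by
  induction x using TensorProduct.induction_on with
  | zero => simp
  | tmul m l =>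
    simp only [corootMap_tmul, LinearMap.flip_apply, h, map_sum, map_smul, Finset.sum_smul,
      smul_smul, smul_eq_mul]
  | add x y hx hy => simp only [map_add, hx, hy, smul_add, Finset.sum_add_distrib]

theorem exists_coroot'_ne_zero [P.IsRootSystem] {v : M} (hv : v ≠ 0) : ∃ i, P.coroot' i v ≠ 0 := by
  by_contra! h
  refine hv (P.toPerfPair.injective ?_)
  rw [map_zero]
  refine LinearMap.ext_on_range (RootPairing.IsRootSystem.span_coroot_eq_top (P := P)) fun i => ?_
  exact h i

theorem exists_coroot'_eq_zero_ne_zero (hdim : 2 ≤ Module.finrank F M) (i : ι) :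
    ∃ v : M, v ≠ 0 ∧ P.coroot' i v = 0 := by
  have : FiniteDimensional F M := Module.finite_of_finrank_pos (by omega)
  have h : LinearMap.ker (P.coroot' i) ≠ ⊥ :=
    LinearMap.ker_ne_bot_of_finrank_lt (by rw [Module.finrank_self]; omega)
  obtain ⟨v, hv, hv'⟩ := (Submodule.ne_bot_iff _).1 h
  exact ⟨v, hv', hv⟩

theorem nonempty_of_two_le_finrank [P.IsRootSystem] (hdim : 2 ≤ Module.finrank F M) :
    Nonempty ι := by
  have : Nontrivial M := Module.nontrivial_of_finrank_pos (R := F) (by omega)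
  obtain ⟨v, hv⟩ := exists_ne (0 : M)
  exact ⟨(exists_coroot'_ne_zero P hv).choose⟩

variable {P} [Fintype ι] [P.IsRootSystem] {B : Finset ι}

/-- Coroots are linear combinations of the simple coroots with coefficients of the same sign. -/
theorem IsRootBasis.coroot_eq_sum (hB : IsRootBasis P B) (i : ι) :
    ∃ c : ι → F, ((∀ j ∈ B, 0 ≤ c j) ∨ (∀ j ∈ B, c j ≤ 0)) ∧
      P.coroot i = ∑ j ∈ B, c j • P.coroot j := by
  obtain ⟨c, hc, h⟩ := hB.2 i
  have hpos : ∀ j, 0 < P.RootForm (P.root j) (P.root j) := fun j =>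
    (P.zero_le_rootForm _).lt_of_ne
      (RootPairing.IsAnisotropic.rootForm_root_ne_zero (P := P) j).symm
  -- Polarization sends each root to a positive multiple of its coroot, so a same-sign expansion of
  -- a root becomes one of its coroot.
  have hE : ∀ j, P.PolarizationEquiv (P.root j) =
      (P.RootForm (P.root j) (P.root j) / 2) • P.coroot j := fun j => by
    have := (hpos j).ne'
    rw [P.coroot_eq_polarizationEquiv_apply_root, smul_smul]
    rw [div_mul_div_cancel₀ two_ne_zero, div_self this, one_smul]
  refine ⟨fun j => 2 / P.RootForm (P.root i) (P.root i) *
    (c j * (P.RootForm (P.root j) (P.root j) / 2)), ?_, ?_⟩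
  · have h2 : ∀ j, 0 ≤ P.RootForm (P.root j) (P.root j) / 2 := fun j =>
      (half_pos (hpos j)).le
    have h3 : 0 ≤ 2 / P.RootForm (P.root i) (P.root i) := (div_pos two_pos (hpos i)).le
    exact hc.imp (fun hc j hj => mul_nonneg h3 (mul_nonneg (hc j hj) (h2 j)))
      (fun hc j hj => mul_nonpos_of_nonneg_of_nonpos h3
        (mul_nonpos_of_nonpos_of_nonneg (hc j hj) (h2 j)))
  · have hs : P.PolarizationEquiv (P.root i) = ∑ j ∈ B, c j • P.PolarizationEquiv (P.root j) := by
      simp only [h, map_sum, map_smul]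
    rw [P.coroot_eq_polarizationEquiv_apply_root, hs, Finset.smul_sum]
    refine Finset.sum_congr rfl fun j _ => ?_
    rw [hE, smul_smul, smul_smul, mul_assoc]

/-- The simple coroots are linearly independent, so some functional takes the value `1` on all of
them, and the perfect pairing represents it by a vector. -/
theorem IsRootBasis.exists_coroot'_eq_one (hB : IsRootBasis P B) :
    ∃ v : M, ∀ j ∈ B, P.coroot' j v = 1 := by
  have hli : LinearIndependent F fun j : (B : Set ι) => P.coroot j := P.linearIndepOn_coroot_iff.2 hB.1
  obtain ⟨f, hf⟩ := LinearMap.exists_extend ((Module.Basis.span hli).constr F fun _ => (1 : F))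
  refine ⟨P.toPerfPair.symm f, fun j hj => ?_⟩
  change P.toLinearMap (P.toPerfPair.symm f) (P.coroot j) = 1
  rw [LinearMap.apply_symm_toPerfPair_self]
  have h1 := (Module.Basis.span hli).constr_basis F (fun _ => (1 : F)) ⟨j, hj⟩
  rw [← hf] at h1
  rw [← h1, LinearMap.comp_apply, Submodule.subtype_apply, Module.Basis.span_apply]

variable [LinearOrder Λ] [IsOrderedAddMonoid Λ] [IsStrictOrderedModule F Λ]

/-- Every coroot has a constant sign on the fundamental chamber, which is the strict sign at a
suitable vector. -/
theorem IsRootBasis.exists_regular (hB : IsRootBasis P B) :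
    ∃ v : M, (∀ j ∈ B, P.coroot' j v = 1) ∧ ∀ i,
      (0 < P.coroot' i v ∧ ∀ x ∈ fundamentalChamber P B Λ, 0 ≤ corootMap P Λ i x) ∨
      (P.coroot' i v < 0 ∧ ∀ x ∈ fundamentalChamber P B Λ, corootMap P Λ i x ≤ 0) := by
  obtain ⟨v, hv⟩ := hB.exists_coroot'_eq_one
  refine ⟨v, hv, fun i => ?_⟩
  obtain ⟨c, hc, h⟩ := hB.coroot_eq_sum i
  have hs : P.coroot' i v = ∑ j ∈ B, c j := by
    simp only [LinearMap.flip_apply, h, map_sum, map_smul, smul_eq_mul]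
    refine Finset.sum_congr rfl fun j hj => ?_
    have := hv j hj
    rw [LinearMap.flip_apply] at this
    rw [this, mul_one]
  have hne : ∃ j ∈ B, c j ≠ 0 := by
    by_contra! h0
    refine P.ne_zero' i ?_
    rw [h]
    exact Finset.sum_eq_zero fun j hj => by rw [h0 j hj, zero_smul]
  obtain ⟨j, hj, hj0⟩ := hne
  refine hc.imp (fun hc => ⟨?_, fun x hx => ?_⟩) (fun hc => ⟨?_, fun x hx => ?_⟩)
  · rw [hs]
    exact Finset.sum_pos' hc ⟨j, hj, (hc j hj).lt_of_ne hj0.symm⟩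
  · rw [corootMap_eq_sum P h]
    exact Finset.sum_nonneg fun j hj => smul_nonneg (hc j hj) (hx j hj)
  · rw [hs]
    exact Finset.sum_neg' hc ⟨j, hj, (hc j hj).lt_of_ne hj0⟩
  · rw [corootMap_eq_sum P h]
    exact Finset.sum_nonpos fun j hj => smul_nonpos_of_nonpos_of_nonneg (hc j hj) (hx j hj)

end RootSystem

/-! ### The partition of the model space into classes -/

section Classes

variable {F : Subfield ℝ} {ι N : Type*} {M : Type u} {Λ : Type v}
  [AddCommGroup M] [Module F M] [AddCommGroup N] [Module F N]
  [AddCommGroup Λ] [Module F Λ] [LinearOrder Λ] (P : RootPairing ι F M N)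

/-- The points whose distance to every wall through the origin is at least `k`. -/
def IsRegularPoint (k : Λ) (x : ModelSpace F M Λ) : Prop := ∀ i, k ≤ |corootMap P Λ i x|

/-- Two points are equivalent if they have the same coordinates, or if they are both regular and
lie in the same Weyl chamber based at the origin. -/
def classSetoid (k : Λ) : Setoid (ModelSpace F M Λ) where
  r x y := (∀ i, corootMap P Λ i x = corootMap P Λ i y) ∨
    (IsRegularPoint P k x ∧ IsRegularPoint P k y ∧
      ∀ i, 0 < corootMap P Λ i x ↔ 0 < corootMap P Λ i y)
  iseqv := by
    refine ⟨fun x => Or.inl fun _ => rfl, ?_, ?_⟩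
    · rintro x y (h | ⟨hx, hy, h⟩)
      · exact Or.inl fun i => (h i).symm
      · exact Or.inr ⟨hy, hx, fun i => (h i).symm⟩
    · rintro x y z (h | ⟨hx, hy, h⟩) (h' | ⟨hy', hz, h'⟩)
      · exact Or.inl fun i => (h i).trans (h' i)
      · exact Or.inr ⟨fun i => by rw [h]; exact hy' i, hz, fun i => by rw [h, h' i]⟩
      · exact Or.inr ⟨hx, fun i => by rw [← h']; exact hy i, fun i => by rw [h i, h']⟩
      · exact Or.inr ⟨hx, hz, fun i => (h i).trans (h' i)⟩

/-- The class of a point. -/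
def pointClass (k : Λ) (x : ModelSpace F M Λ) : Quotient (classSetoid P k) := Quotient.mk _ x

variable {P} {k : Λ}

theorem pointClass_eq_iff {x y : ModelSpace F M Λ} : pointClass P k x = pointClass P k y ↔
    (∀ i, corootMap P Λ i x = corootMap P Λ i y) ∨
    (IsRegularPoint P k x ∧ IsRegularPoint P k y ∧
      ∀ i, 0 < corootMap P Λ i x ↔ 0 < corootMap P Λ i y) :=
  Quotient.eq (r := classSetoid P k)

theorem pos_iff_of_pointClass_eq {x y : ModelSpace F M Λ} (h : pointClass P k x = pointClass P k y)
    (i : ι) : 0 < corootMap P Λ i x ↔ 0 < corootMap P Λ i y := by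
  obtain h | h := pointClass_eq_iff.1 h
  · rw [h]
  · exact h.2.2 i

theorem pointClass_eq_iff_of_not_isRegularPoint {x y : ModelSpace F M Λ}
    (hy : ¬ IsRegularPoint P k y) :
    pointClass P k x = pointClass P k y ↔ ∀ i, corootMap P Λ i x = corootMap P Λ i y := by
  rw [pointClass_eq_iff, or_iff_left fun h => hy h.2.1]

theorem pointClass_eq_iff_of_isRegularPoint {x y : ModelSpace F M Λ}
    (hy : IsRegularPoint P k y) :
    pointClass P k x = pointClass P k y ↔
      IsRegularPoint P k x ∧ ∀ i, 0 < corootMap P Λ i x ↔ 0 < corootMap P Λ i y := by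
  rw [pointClass_eq_iff]
  constructor
  · rintro (h | ⟨hx, -, h⟩)
    · exact ⟨fun i => by rw [h]; exact hy i, fun i => by rw [h]⟩
    · exact ⟨hx, h⟩
  · exact fun h => Or.inr ⟨h.1, hy, h.2⟩

theorem isRegularPoint_reflection_iff (m : ι) {x : ModelSpace F M Λ} :
    IsRegularPoint P k ((P.reflection m).rTensor Λ x) ↔ IsRegularPoint P k x := by
  unfold IsRegularPoint
  simp only [corootMap_reflection]
  exact (P.reflectionPerm m).forall_congr_right (q := fun i => k ≤ |corootMap P Λ i x|)

theorem pointClass_reflection_eq_iff (m : ι) {x y : ModelSpace F M Λ}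
    (hy : IsRegularPoint P k y) :
    pointClass P k ((P.reflection m).rTensor Λ x) = pointClass P k y ↔
      pointClass P k x = pointClass P k ((P.reflection m).rTensor Λ y) := by
  rw [pointClass_eq_iff_of_isRegularPoint hy,
    pointClass_eq_iff_of_isRegularPoint ((isRegularPoint_reflection_iff m).2 hy),
    isRegularPoint_reflection_iff]
  refine and_congr_right fun _ => ?_
  simp only [corootMap_reflection]
  exact ⟨fun h i => by simpa only [P.reflectionPerm_self] using h (P.reflectionPerm m i),
    fun h i => by simpa only [P.reflectionPerm_self] using h (P.reflectionPerm m i)⟩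

end Classes

/-! ### Convexity and gluing of classes; half-apartments and chambers -/

section Classes

variable {F : Subfield ℝ} {ι N : Type*} {M : Type u} {Λ : Type v}
  [AddCommGroup M] [Module F M] [AddCommGroup N] [Module F N]
  [AddCommGroup Λ] [Module F Λ] [LinearOrder Λ] [IsOrderedAddMonoid Λ] {P : RootPairing ι F M N}
  {k : Λ}

/-- The reflection in the root `m` changes the sign of the coroot `m`, which does not vanish at a
regular point. -/
theorem pointClass_reflection_ne (hk : 0 < k) (m : ι) {y : ModelSpace F M Λ}
    (hy : IsRegularPoint P k y) :
    pointClass P k y ≠ pointClass P k ((P.reflection m).rTensor Λ y) := by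
  intro h
  have h1 := pos_iff_of_pointClass_eq h m
  rw [corootMap_reflection, corootMap_reflectionPerm_self, neg_pos] at h1
  have h2 : corootMap P Λ m y ≠ 0 := abs_pos.1 (hk.trans_le (hy m))
  obtain h3 | h3 := h2.lt_or_gt
  · exact absurd (h1.2 h3) h3.not_gt
  · exact absurd (h1.1 h3) h3.not_gt

theorem not_isRegularPoint_zero [Nonempty ι] (hk : 0 < k) :
    ¬ IsRegularPoint P k (0 : ModelSpace F M Λ) := fun h => by
  have := h (Classical.arbitrary ι)
  rw [map_zero, abs_zero] at this
  exact this.not_gt hk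

/-- For a regular class, prescribing the sign of a coroot turns the bound on its absolute value into
one linear inequality. Any other class is cut out by equalities, each being a pair of inequalities
for a root and its negative. -/
theorem isClosedConvex_pointClass_fiber [Fintype ι] (hk : 0 < k)
    (κ : Quotient (classSetoid P k)) : IsClosedConvex P (pointClass P k ⁻¹' {κ}) := by
  classical
  obtain ⟨a, rfl⟩ := Quotient.exists_rep κ
  change IsClosedConvex P {x | pointClass P k x = pointClass P k a}
  by_cases ha : IsRegularPoint P k a
  -- `P.reflectionPerm i i` is the index of the negative of the root `i`.
  · refine ⟨Finset.univ.image fun i =>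
      if 0 < corootMap P Λ i a then (i, k) else (P.reflectionPerm i i, k), ?_⟩
    ext x
    rw [Set.mem_ofPred_eq, Set.mem_ofPred_eq, Finset.forall_mem_image,
      pointClass_eq_iff_of_isRegularPoint ha]
    unfold IsRegularPoint
    rw [← forall_and]
    refine forall_congr' fun i => ?_
    simp only [Finset.mem_univ, true_imp_iff]
    split_ifs with h
    · simp only [h, iff_true]
      constructor
      · rintro ⟨h1, h2⟩
        rwa [abs_of_pos h2] at h1
      · intro h1
        exact ⟨h1.trans (le_abs_self _), hk.trans_le h1⟩
    · simp only [h, iff_false, corootMap_reflectionPerm_self, not_lt]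
      constructor
      · rintro ⟨h1, h2⟩
        rwa [abs_of_nonpos h2] at h1
      · intro h1
        exact ⟨h1.trans (neg_le_abs _), neg_nonneg.1 (hk.le.trans h1)⟩
  · refine ⟨Finset.univ.image fun i => (i, corootMap P Λ i a), ?_⟩
    ext x
    rw [Set.mem_ofPred_eq, Set.mem_ofPred_eq, Finset.forall_mem_image,
      pointClass_eq_iff_of_not_isRegularPoint ha]
    simp only [Finset.mem_univ, true_imp_iff]
    refine ⟨fun h i => (h i).ge, fun h i => le_antisymm ?_ (@h i)⟩
    have := @h (P.reflectionPerm i i)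
    rwa [corootMap_reflectionPerm_self, corootMap_reflectionPerm_self, neg_le_neg_iff] at this

/-- Gluing of two classes. Classes of points that are not regular are glued at the positions of the
origin and `q`. -/
theorem exists_glue [Nonempty ι] (hk : 0 < k) {q : ModelSpace F M Λ} (hq : ¬ IsRegularPoint P k q)
    (hq0 : pointClass P k (0 : ModelSpace F M Λ) ≠ pointClass P k q)
    (κ κ' : Quotient (classSetoid P k)) :
    ∃ i j : Quotient (classSetoid P k), ∃ w ∈ affineWeylGroup P Λ, ∃ w' ∈ affineWeylGroup P Λ,
      i ≠ j ∧ (∀ x, pointClass P k (w x) = κ ↔ pointClass P k x = i) ∧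
      (∀ x, pointClass P k (w' x) = κ' ↔ pointClass P k x = j) ∧
      ∀ b, ¬ IsRegularPoint P k b → κ = pointClass P k b → κ' = pointClass P k b →
        i = pointClass P k 0 ∧ j = pointClass P k q := by
  have trans : ∀ a b : ModelSpace F M Λ, ¬ IsRegularPoint P k a → ¬ IsRegularPoint P k b →
      ∃ w ∈ affineWeylGroup P Λ, ∀ x,
        pointClass P k (w x) = pointClass P k a ↔ pointClass P k x = pointClass P k b := by
    intro a b ha hb
    refine ⟨_, constVAdd_mem_affineWeylGroup P (a - b), fun x => ?_⟩
    rw [pointClass_eq_iff_of_not_isRegularPoint ha, pointClass_eq_iff_of_not_isRegularPoint hb]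
    refine forall_congr' fun i => ?_
    rw [AffineEquiv.constVAdd_apply, vadd_eq_add, map_add, map_sub, sub_add_eq_add_sub,
      sub_eq_iff_eq_add, add_right_inj]
  have h0 := not_isRegularPoint_zero (P := P) hk
  have reg : ∀ a b : ModelSpace F M Λ, IsRegularPoint P k b → pointClass P k a = pointClass P k b →
      IsRegularPoint P k a := fun a b hb h => ((pointClass_eq_iff_of_isRegularPoint hb).1 h).1
  obtain ⟨a, rfl⟩ := Quotient.exists_rep κ
  obtain ⟨b, rfl⟩ := Quotient.exists_rep κ'
  change ∃ i j : Quotient (classSetoid P k), ∃ w ∈ affineWeylGroup P Λ,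
    ∃ w' ∈ affineWeylGroup P Λ,
      i ≠ j ∧ (∀ x, pointClass P k (w x) = pointClass P k a ↔ pointClass P k x = i) ∧
      (∀ x, pointClass P k (w' x) = pointClass P k b ↔ pointClass P k x = j) ∧
      ∀ c, ¬ IsRegularPoint P k c → pointClass P k a = pointClass P k c →
        pointClass P k b = pointClass P k c → i = pointClass P k 0 ∧ j = pointClass P k q
  by_cases ha : IsRegularPoint P k a
  · have hvac : ∀ c, ¬ IsRegularPoint P k c → pointClass P k a ≠ pointClass P k c :=
      fun c hc h => hc (reg _ _ ha h.symm)
    by_cases hb : IsRegularPoint P k b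
    · by_cases hab : pointClass P k a = pointClass P k b
      -- Two points of the same regular kind need different positions: one copy is reflected into
      -- another chamber.
      · let m := Classical.arbitrary ι
        exact ⟨_, _, 1, one_mem _, _, reflection_mem_affineWeylGroup P m,
          hab ▸ pointClass_reflection_ne hk m hb, fun x => Iff.rfl,
          fun x => pointClass_reflection_eq_iff m hb, fun c hc h => (hvac c hc h).elim⟩
      · exact ⟨_, _, 1, one_mem _, 1, one_mem _, hab, fun x => Iff.rfl, fun x => Iff.rfl,
          fun c hc h => (hvac c hc h).elim⟩
    -- A regular class keeps its position; the other class is translated to that of the origin,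
    -- which is not regular.
    · obtain ⟨w, hw, h⟩ := trans b 0 hb h0
      exact ⟨_, _, 1, one_mem _, w, hw, (hvac 0 h0), fun x => Iff.rfl, h,
        fun c hc h => (hvac c hc h).elim⟩
  · by_cases hb : IsRegularPoint P k b
    · have hvac : ∀ c, ¬ IsRegularPoint P k c → pointClass P k b ≠ pointClass P k c :=
        fun c hc h => hc (reg _ _ hb h.symm)
      obtain ⟨w, hw, h⟩ := trans a 0 ha h0
      exact ⟨_, _, w, hw, 1, one_mem _, (hvac 0 h0).symm, h, fun x => Iff.rfl,
        fun c hc _ h => (hvac c hc h).elim⟩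
    · obtain ⟨w, hw, h⟩ := trans a 0 ha h0
      obtain ⟨w', hw', h'⟩ := trans b q hb hq
      exact ⟨_, _, w, hw, w', hw', hq0, h, h', fun _ _ _ _ => ⟨rfl, rfl⟩⟩

/-- A gluing of the classes that puts any class of points that are not regular at the positions of
the origin and `q`. -/
theorem exists_gluing [Nonempty ι] (hk : 0 < k) {q : ModelSpace F M Λ}
    (hq : ¬ IsRegularPoint P k q)
    (hq0 : pointClass P k (0 : ModelSpace F M Λ) ≠ pointClass P k q) :
    ∃ G : Gluing P (pointClass P k), ∀ b, ¬ IsRegularPoint P k b →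
      G.left (pointClass P k b) (pointClass P k b) = pointClass P k 0 ∧
      G.right (pointClass P k b) (pointClass P k b) = pointClass P k q := by
  choose i j w hw w' hw' hij h h' hb using exists_glue hk hq hq0
  exact ⟨⟨i, j, w, w', hij, hw, hw', h, h'⟩, fun b hb' => hb _ _ b hb' rfl rfl⟩

theorem IsHalfApartment.ne_univ [Nontrivial Λ] {H : Set (ModelSpace F M Λ)}
    (hH : IsHalfApartment P H) : H ≠ Set.univ := by
  obtain ⟨i, c, rfl⟩ := hH
  obtain ⟨l, hl⟩ := exists_gt (0 : Λ)
  intro h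
  have h1 : P.root i ⊗ₜ[F] (-(|c| + l)) ∈ {x : ModelSpace F M Λ | c ≤ corootMap P Λ i x} :=
    h ▸ Set.mem_univ _
  rw [Set.mem_ofPred_eq, corootMap_tmul, P.root_coroot'_eq_pairing, P.pairing_same, two_smul] at h1
  have h2 := neg_abs_le c
  have h3 := abs_nonneg c
  have h4 : -(|c| + l) + -(|c| + l) < -|c| := by
    have : -(|c| + l) + -(|c| + l) = -|c| - (|c| + l + l) := by abel
    rw [this, sub_lt_self_iff]
    positivity
  exact (h1.trans_lt h4).not_ge h2

/-- In dimension at least two there is a nonzero direction `v` parallel to the wall. Going far along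
`v` and `-v` stays in the half-apartment but gives some other coroot opposite signs. -/
theorem IsHalfApartment.exists_pointClass_ne [IsStrictOrderedModule F Λ] [Nontrivial Λ]
    [P.IsRootSystem]
    (hdim : 2 ≤ Module.finrank F M) {H : Set (ModelSpace F M Λ)} (hH : IsHalfApartment P H) :
    ∃ x ∈ H, ∃ y ∈ H, pointClass P k x ≠ pointClass P k y := by
  obtain ⟨i, c, rfl⟩ := hH
  obtain ⟨l, hl⟩ := exists_gt (0 : Λ)
  obtain ⟨v, hv, hiv⟩ := exists_coroot'_eq_zero_ne_zero P hdim i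
  obtain ⟨j, hj⟩ := exists_coroot'_ne_zero P hv
  set x : ModelSpace F M Λ := P.root i ⊗ₜ[F] |c| with hx
  set y : ModelSpace F M Λ := v ⊗ₜ[F] ((P.coroot' j v)⁻¹ • (|corootMap P Λ j x| + l)) with hy
  have hix : c ≤ corootMap P Λ i x := by
    rw [hx, corootMap_tmul, P.root_coroot'_eq_pairing, P.pairing_same, two_smul]
    exact (le_abs_self c).trans (le_add_of_nonneg_left (abs_nonneg c))
  have hiy : corootMap P Λ i y = 0 := by rw [hy, corootMap_tmul, hiv, zero_smul]
  have hjy : corootMap P Λ j y = |corootMap P Λ j x| + l := by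
    rw [hy, corootMap_tmul, smul_smul, mul_inv_cancel₀ hj, one_smul]
  refine ⟨x + y, ?_, x - y, ?_, fun h => ?_⟩
  · rwa [Set.mem_ofPred_eq, map_add, hiy, add_zero]
  · rwa [Set.mem_ofPred_eq, map_sub, hiy, sub_zero]
  · have h1 := pos_iff_of_pointClass_eq h j
    rw [map_add, map_sub, hjy] at h1
    have h2 : 0 < corootMap P Λ j x + (|corootMap P Λ j x| + l) := by
      rw [← add_assoc]
      exact add_pos_of_nonneg_of_pos (neg_le_iff_add_nonneg'.1 (neg_le_abs _)) hl
    have h3 := h1.1 h2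
    rw [sub_pos] at h3
    exact absurd (h3.trans_le (le_abs_self _)) (lt_add_of_pos_right _ hl).not_gt

/-- Shifting the chamber far along a vector on which every coroot is nonzero, with the sign it has
on the chamber, makes all coroot values large with constant sign. -/
theorem IsWeylChamber.exists_subset_fiber [IsStrictOrderedModule F Λ] [Fintype ι]
    [P.IsRootSystem] (hk : 0 < k) {B : Finset ι} (hB : IsRootBasis P B)
    {C : Set (ModelSpace F M Λ)} (hC : IsWeylChamber P B C) :
    ∃ C' ⊆ C, IsWeylChamber P B C' ∧ ∃ κ, C' ⊆ pointClass P k ⁻¹' {κ} := by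
  obtain ⟨w, hw, rfl⟩ := hC
  obtain ⟨v, hv, hreg⟩ := hB.exists_regular (Λ := Λ)
  choose j c h using exists_corootMap_of_mem_affineWeylGroup P hw
  have hne : ∀ i, P.coroot' i v ≠ 0 := fun i => (hreg i).elim (fun h => h.1.ne') (fun h => h.1.ne)
  -- Summing over all `i` bounds each term at once; each is large enough to absorb both `k` and the
  -- translation constant `c i`.
  set l : Λ := ∑ i, |P.coroot' (j i) v|⁻¹ • (|k| + |c i|) with hl
  have hterm : ∀ i, 0 ≤ |P.coroot' (j i) v|⁻¹ • (|k| + |c i|) := fun i =>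
    smul_nonneg (inv_nonneg.2 (abs_nonneg _)) (by positivity)
  have hl0 : 0 ≤ l := Finset.sum_nonneg fun i _ => hterm i
  have hli : ∀ i, |k| + |c i| ≤ |P.coroot' (j i) v| • l := by
    intro i
    have h1 : |P.coroot' (j i) v|⁻¹ • (|k| + |c i|) ≤ l :=
      Finset.single_le_sum (f := fun i => |P.coroot' (j i) v|⁻¹ • (|k| + |c i|))
        (fun i _ => hterm i) (Finset.mem_univ i)
    have h2 := smul_le_smul_of_nonneg_left h1 (abs_nonneg (P.coroot' (j i) v))
    rwa [smul_smul, mul_inv_cancel₀ (abs_pos.2 (hne _)).ne', one_smul] at h2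
  have key : ∀ x ∈ fundamentalChamber P B Λ, ∀ i,
      k ≤ |corootMap P Λ i (w (x + v ⊗ₜ[F] l))| ∧
      (0 < corootMap P Λ i (w (x + v ⊗ₜ[F] l)) ↔ 0 < P.coroot' (j i) v) := by
    intro x hx i
    have hli := hli i
    rw [abs_of_pos hk] at hli
    rw [h, map_add, corootMap_tmul]
    obtain ⟨h1, h2⟩ | ⟨h1, h2⟩ := hreg (j i)
    · rw [abs_of_pos h1] at hli
      have h3 : k ≤ corootMap P Λ (j i) x + P.coroot' (j i) v • l + c i := by
        calc k = 0 + (k + |c i|) + -|c i| := by abel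
          _ ≤ _ := add_le_add (add_le_add (h2 x hx) hli) (neg_abs_le _)
      exact ⟨h3.trans (le_abs_self _), iff_of_true (hk.trans_le h3) h1⟩
    · rw [abs_of_neg h1, neg_smul] at hli
      have h3 : corootMap P Λ (j i) x + P.coroot' (j i) v • l + c i ≤ -k := by
        calc _ ≤ 0 + -(k + |c i|) + |c i| :=
              add_le_add (add_le_add (h2 x hx) (le_neg_of_le_neg hli)) (le_abs_self _)
          _ = -k := by abel
      exact ⟨(le_neg_of_le_neg h3).trans (neg_le_abs _),
        iff_of_false (h3.trans_lt (neg_neg_of_pos hk)).not_gt h1.not_gt⟩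
  have hw' : ∀ x, (w * AffineEquiv.constVAdd F (ModelSpace F M Λ) (v ⊗ₜ[F] l) :
      ModelSpace F M Λ ≃ᵃ[F] ModelSpace F M Λ) x = w (x + v ⊗ₜ[F] l) := fun x =>
    congrArg w (add_comm (v ⊗ₜ[F] l) x)
  refine ⟨_, ?_, ⟨w * AffineEquiv.constVAdd F _ (v ⊗ₜ[F] l),
    mul_mem hw (constVAdd_mem_affineWeylGroup P _), rfl⟩, pointClass P k (w (0 + v ⊗ₜ[F] l)), ?_⟩
  · rintro _ ⟨x, hx, rfl⟩
    rw [hw']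
    refine ⟨_, fun i hi => ?_, rfl⟩
    rw [map_add, corootMap_tmul, hv i hi, one_smul]
    exact add_nonneg (hx i hi) hl0
  · rintro _ ⟨x, hx, rfl⟩
    rw [hw']
    have h0 : (0 : ModelSpace F M Λ) ∈ fundamentalChamber P B Λ := fun i _ => by rw [map_zero]
    exact pointClass_eq_iff.2 (Or.inr ⟨fun i => (key x hx i).1, fun i => (key 0 h0 i).1,
      fun i => (key x hx i).2.trans (key 0 h0 i).2.symm⟩)

end Classes

/-! ### Consequences of topological equivalence with the natural metric -/

section Metric

variable {F : Subfield ℝ} {ι N : Type*} {M : Type u} {Λ : Type v} [Fintype ι]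
  [AddCommGroup M] [Module F M] [AddCommGroup N] [Module F N]
  [AddCommGroup Λ] [Module F Λ] [LinearOrder Λ] [IsOrderedAddMonoid Λ] {P : RootPairing ι F M N}
  {d : ModelSpace F M Λ → ModelSpace F M Λ → Λ}

theorem IsLambdaMetric.nonneg {Y : Type*} {d : Y → Y → Λ} (hd : IsLambdaMetric d) (x y : Y) :
    0 ≤ d x y := by
  have h := hd.triangle x x y
  rw [(hd.eq_zero_iff x x).2 rfl, hd.symm y x] at h
  by_contra! h'
  exact (add_neg h' h').not_ge h

/-- Points with equal coroot values have natural distance zero, so by topological equivalence their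
`d`-distance lies below every positive bound, in particular below itself if positive. Hence the
classes of nonregular points are singletons. -/
theorem IsModelMetric.eq_of_corootMap_eq (hd : IsModelMetric P d) {x y : ModelSpace F M Λ}
    (h : ∀ i, corootMap P Λ i x = corootMap P Λ i y) : x = y := by
  rw [← hd.isLambdaMetric.eq_zero_iff]
  by_contra hne
  have hpos := (hd.isLambdaMetric.nonneg x y).lt_of_ne (Ne.symm hne)
  obtain ⟨δ, hδ, hlt⟩ := (hd.topEquivalent x _ hpos).2
  refine (hlt y ?_).ne rfl
  have : naturalMetric P x y = 0 := Finset.sum_eq_zero fun i _ => by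
    rw [map_sub, h, sub_self, abs_zero]
  rwa [this]

theorem naturalMetric_zero_tmul [IsStrictOrderedModule F Λ] (m : M) {l : Λ} (hl : 0 ≤ l) :
    naturalMetric P 0 (m ⊗ₜ[F] l) = (∑ i, |P.coroot' i m|) • l := by
  rw [Finset.sum_smul]
  refine Finset.sum_congr rfl fun i _ => ?_
  rw [zero_sub, map_neg, abs_neg, corootMap_tmul, abs_smul, abs_of_nonneg hl]

/-- On the line through a root there are points close to the origin compared to a given point. -/
theorem IsModelMetric.exists_close_point [IsStrictOrderedModule F Λ] (hd : IsModelMetric P d)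
    (i : ι) {l : Λ} (hl : 0 < l) : ∃ m, 0 < m ∧ m < l ∧
      d 0 (P.root i ⊗ₜ[F] m) + d 0 (P.root i ⊗ₜ[F] m) < d 0 (P.root i ⊗ₜ[F] l) := by
  have hne : (0 : ModelSpace F M Λ) ≠ P.root i ⊗ₜ[F] l := fun h => by
    have h' := congrArg (corootMap P Λ i) h
    rw [map_zero, corootMap_tmul, P.root_coroot'_eq_pairing, P.pairing_same, two_smul] at h'
    exact (add_pos hl hl).ne h'
  have hD : 0 < d 0 (P.root i ⊗ₜ[F] l) := (hd.isLambdaMetric.nonneg _ _).lt_of_ne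
    fun h => hne ((hd.isLambdaMetric.eq_zero_iff _ _).1 h.symm)
  have hhalf : (0 : F) < 1 / 2 := one_half_pos
  obtain ⟨δ, hδ, hlt⟩ := (hd.topEquivalent 0 _ (smul_pos hhalf hD)).2
  set c : F := ∑ j, |P.coroot' j (P.root i)| with hc
  have hc0 : 0 ≤ c := Finset.sum_nonneg fun j _ => abs_nonneg _
  have hc2 : 0 < c + 2 := by linarith
  have hμ : 0 < min δ l := lt_min hδ hl
  -- The summand `2` makes both `c` and `1` smaller than `c + 2`: the case `c` bounds the natural
  -- distance by `δ`, the case `1` gives `m < l`.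
  have hscale : ∀ t : F, t < c + 2 → t • (c + 2)⁻¹ • min δ l < min δ l := fun t ht => by
    rw [smul_smul]
    refine smul_lt_of_lt_one_left hμ ?_
    rwa [← div_eq_mul_inv, div_lt_one hc2]
  refine ⟨(c + 2)⁻¹ • min δ l, smul_pos (inv_pos.2 hc2) hμ, ?_, ?_⟩
  · have := hscale 1 (by linarith)
    rw [one_smul] at this
    exact this.trans_le (min_le_right _ _)
  · have h1 := hlt (P.root i ⊗ₜ[F] ((c + 2)⁻¹ • min δ l)) (by
      rw [naturalMetric_zero_tmul _ (smul_nonneg (inv_nonneg.2 hc2.le) hμ.le)]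
      exact (hscale c (by linarith)).trans_le (min_le_left _ _))
    refine (add_lt_add h1 h1).trans_eq ?_
    rw [← add_smul, add_halves, one_smul]

end Metric

end LambdaBuilding

/-! ### The main theorem -/

open LambdaBuilding in
theorem mainTheorem9 {F : Subfield ℝ} {ι N : Type*} {M : Type u} {Λ : Type v}
    [Fintype ι] [AddCommGroup M] [Module F M] [AddCommGroup N] [Module F N]
    [AddCommGroup Λ] [LinearOrder Λ] [IsOrderedAddMonoid Λ] [Module F Λ]
    [IsStrictOrderedModule F Λ]
    (P : RootPairing ι F M N) [P.IsRootSystem] (B : Finset ι) (hB : IsRootBasis P B)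
    (hdim : 2 ≤ Module.finrank F M)
    (lam : ℕ → Λ) (hpos : 0 < lam 0) (hmono : StrictMono lam)
    (hlim : Filter.Tendsto lam Filter.atTop Filter.atTop)
    (d : ModelSpace F M Λ → ModelSpace F M Λ → Λ) (hd : IsModelMetric P d) :
    (∃ (X : Type (max u v)) (𝒜 : Set (ModelSpace F M Λ → X)),
      IsModeledSpace 𝒜 ∧ A1 P 𝒜 ∧ A2 P 𝒜 ∧ A3 𝒜 ∧ A4 P B 𝒜 ∧
      (∀ f ∈ 𝒜, ∀ g ∈ 𝒜, ¬ IsHalfApartmentOf P 𝒜 (Set.range f ∩ Set.range g)) ∧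
      A6 P 𝒜 ∧ ¬ A5 𝒜 d ∧ ¬ TI 𝒜 d) ∧
    ¬ ∀ (X : Type (max u v)) (𝒜 : Set (ModelSpace F M Λ → X)),
      IsModeledSpace 𝒜 → A1 P 𝒜 → A2 P 𝒜 → A3 𝒜 → A4 P B 𝒜 → A6 P 𝒜 →
        IsAffineBuilding P B d 𝒜 := by
  refine (and_iff_left_of_imp ?_).2 ?_
  · rintro ⟨X, 𝒜, hX, h1, h2, h3, h4, -, h6, h5, -⟩ h
    exact h5 (h X 𝒜 hX h1 h2 h3 h4 h6).a5
  have : Nonempty ι := nonempty_of_two_le_finrank P hdim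
  have : Nontrivial Λ := ⟨_, _, hpos.ne⟩
  let i := Classical.arbitrary ι
  obtain ⟨m, hm, hml, hlt⟩ := hd.exists_close_point i hpos
  set l := lam 0
  -- A coroot takes the value `2` on its root, so `P.root i ⊗ₜ[F] l` has coordinate `l + l < k` and
  -- is not regular.
  set k : Λ := l + l + l with hk
  have hk0 : 0 < k := add_pos (add_pos hpos hpos) hpos
  have hroot : ∀ t : Λ, corootMap P Λ i (P.root i ⊗ₜ[F] t) = t + t := fun t => by
    rw [corootMap_tmul, P.root_coroot'_eq_pairing, P.pairing_same, two_smul]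
  have hreg : ∀ t : Λ, 0 < t → t ≤ l → ¬ IsRegularPoint P k (P.root i ⊗ₜ[F] t) := by
    intro t ht htl h
    have h1 := h i
    rw [hroot, abs_of_pos (add_pos ht ht), hk] at h1
    exact h1.not_gt (lt_add_of_le_of_pos (add_le_add htl htl) hpos)
  have hne0 : ∀ t : Λ, 0 < t →
      pointClass P k (P.root i ⊗ₜ[F] t) ≠ pointClass P k 0 := by
    intro t ht h
    have h1 := (pos_iff_of_pointClass_eq h i).1 (by rw [hroot]; exact add_pos ht ht)
    rw [map_zero] at h1
    exact h1.false
  have hne : pointClass P k (P.root i ⊗ₜ[F] m) ≠ pointClass P k (P.root i ⊗ₜ[F] l) := by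
    intro h
    have h1 := (pointClass_eq_iff_of_not_isRegularPoint (hreg l hpos le_rfl)).1 h i
    rw [hroot, hroot] at h1
    exact (add_lt_add hml hml).ne h1
  obtain ⟨G, hG⟩ := exists_gluing hk0 (hreg l hpos le_rfl) (hne0 l hpos).symm
  have hsing : ∀ b ∈ ({0, P.root i ⊗ₜ[F] m} : Set (ModelSpace F M Λ)), ¬ IsRegularPoint P k b := by
    rintro b (rfl | rfl)
    · exact not_isRegularPoint_zero hk0
    · exact hreg m hm hml.le
  have hcls := isClosedConvex_pointClass_fiber (P := P) hk0
  obtain ⟨T, I, S, hTI⟩ := G.exists_system_not_TI hcls (hne0 m hm) hne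
    (fun b hb x hx => hd.eq_of_corootMap_eq
      ((pointClass_eq_iff_of_not_isRegularPoint (hsing b hb)).1 hx))
    (fun b hb => (hG b (hsing b hb)).1) (fun b hb => (hG b (hsing b hb)).2)
    hd.invariant hd.isLambdaMetric.symm hlt
  have hhalf := S.not_isHalfApartmentOf_inter fun H hH =>
    ⟨hH.ne_univ, hH.exists_pointClass_ne hdim⟩
  have hA2 := S.a2_atlas hcls
  exact ⟨S.Space, S.atlas, S.isModeledSpace_atlas, S.a1_atlas, hA2, S.a3_atlas,
    S.a4_atlas fun C hC => hC.exists_subset_fiber hk0 hB, hhalf,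
    A6_of_not_isHalfApartmentOf_inter hhalf,
    fun h5 => hTI (TI_of_A5 S.isModeledSpace_atlas hA2 S.a3_atlas h5 hd.invariant
      hd.isLambdaMetric.triangle), hTI⟩
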